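/- Let $f:\mathbb R\to\mathbb R$ be smooth, $F'=f$, and let $u(x;a,E,c,b)$, $(a,E,c,b)\in\Omega$ with $\Omega\subset\mathbb R^4$ open, be a family of nonconstant periodic functions of $x\in\mathbb R$, smooth in $(x,a,E,c,b)$, with $$-u''+\hat c\,u-f(u)=-(a+cb),\qquad E=\tfrac12(u')^2-(a+cb)u-\tfrac12\hat c\,u^2+F(u),\qquad \hat c:=1-c^2 .$$ Put $v:=b-cu$, let $T$ be the least positive period of $u$, and let $$M_1=\int_0^T u\,dx,\qquad \widetilde P=\int_0^T uv\,dx=-c\int_0^Tu^2\,dx+bM_1,\qquad M_2=\int_0^T v\,dx=bT-cM_1 .$$ Then $T,M_1,\widetilde P,M_2$ are smooth functions on $\Omega$. Fix a point of $\Omega$ and write $U$ for the wave at this point, $\overline U=M_1/T$. On the space $H_0$ of mean-zero functions in $L^2_{\rm per}(0,T)$, with orthogonal projection $\Pi_0:L^2_{\rm per}\to H_0$, let $\mathcal L_2=-\partial_x^2+\hat c-f'(U)$ and $\mathcal A=-\partial_x(\Pi_0\mathcal L_2\Pi_0)\partial_x$ on its natural domain, and assume $\ker\mathcal A=\operatorname{span}\{U-\overline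 U\}$. Let $\mathcal A^{-1}$ be the inverse of $\mathcal A$ on $(\ker\mathcal A)^\perp$. For a basis vector $e$ of $\ker\mathcal A$, the matrix representation of $(\mathcal I-4(1-\hat c)\partial_x\mathcal A^{-1}\partial_x)|_{\ker\mathcal A}$ in the basis $e$ is the scalar $$S_e:=\big\langle e,(\mathcal I-4(1-\hat c)\,\partial_x\mathcal A^{-1}\partial_x)\,e\big\rangle .$$ Let $$\Delta:=\det\begin{pmatrix}T_a&M_{1,a}\\T_E&M_{1,E}\end{pmatrix},\qquad J:=\det\begin{pmatrix}T_E&M_{1,E}&\widetilde P_E&M_{2,E}\\T_a&M_{1,a}&\widetilde P_a&M_{2,a}\\T_c&M_{1,c}&\widetilde P_c&M_{2,c}\\T_b&M_{1,b}&\widetilde P_b&M_{2,b}\end{pmatrix}.$$ Then $T>0$, $\Delta\neq0$, $S_e$ is well defined, and $$T\,\Delta\;S_{U-\overline U}=J;$$ equivalently, in the basis $e=T\Delta\,(U-\overline U)$ of $\ker\mathcal A$, $$S_e=T\,\Delta\,J .$$ Consequently, if $S_{U-\overline U}\neq0$ (equivalently, if the scalar is nonzero in some basis of $\ker\mathcal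 A$), then $(a,E,c,b)\mapsto(T,M_1,\widetilde P,M_2)$ is a smooth local diffeomorphism from a neighborhood of the given point onto a neighborhood of its image. -/

import Mathlib

open MeasureTheory
open scoped ContDiff

namespace GoodBoussinesq

noncomputable section

/-! ### The space of square-integrable periodic functions and the operators on it -/

/-- Real square-integrable functions over one period `(0, T]`, i.e. the space `L²_per` of
`T`-periodic functions, as a Hilbert space. -/
abbrev L2per (T : ℝ) : Type := Lp ℝ 2 (volume.restrict (Set.Ioc (0 : ℝ) T))

/-- The element of `L²_per` given by a function `g` (the value `0` is only taken
if `g` is not square-integrable over a period, in particular never for continuous `g`). -/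
def toL2per (T : ℝ) (g : ℝ → ℝ) : L2per T :=
  open Classical in
  if h : MemLp g 2 (volume.restrict (Set.Ioc (0 : ℝ) T)) then h.toLp g else 0

/-- The graph of the closed operator `∂ₓ` on `L²_per` (its domain is `H¹_per`): `v` is the
weak derivative of `u`, tested against all smooth `T`-periodic functions. -/
def IsDeriv {T : ℝ} (u v : L2per T) : Prop :=
  ∀ φ : ℝ → ℝ, ContDiff ℝ ∞ φ → Function.Periodic φ T →
    ∫ x in (0 : ℝ)..T, u x * deriv φ x = - ∫ x in (0 : ℝ)..T, v x * φ x

/-- The orthogonal projection `Π₀ u = u - (1/T) ⟨u, 1⟩` onto the mean-zero functions. -/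
def proj₀ {T : ℝ} (u : L2per T) : L2per T :=
  u - (1 / T * ∫ x in (0 : ℝ)..T, u x) • toL2per T (fun _ => 1)

/-- The graph of the Hill operator `-∂ₓ² + q` on `L²_per` (its domain is `H²_per`
when `q` is continuous and periodic). -/
def IsHill {T : ℝ} (q : ℝ → ℝ) (u z : L2per T) : Prop :=
  ∃ v w : L2per T, IsDeriv u v ∧ IsDeriv v w ∧
    ∀ᵐ x ∂(volume.restrict (Set.Ioc (0 : ℝ) T)), z x = - w x + q x * u x

/-- The graph of `𝒜 = -∂ₓ (Π₀ ℒ₂ Π₀) ∂ₓ` on the space `H₀` of mean-zero functions in `L²_per`,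
where `ℒ₂ = -∂ₓ² + q`, on its maximal domain. -/
def IsA {T : ℝ} (q : ℝ → ℝ) (u w : L2per T) : Prop :=
  ∫ x in (0 : ℝ)..T, u x = 0 ∧
    ∃ v z y : L2per T, IsDeriv u v ∧ IsHill q (proj₀ v) z ∧ IsDeriv (proj₀ z) y ∧ w = - y

/-- `ker 𝒜`. -/
def kerA {T : ℝ} (q : ℝ → ℝ) : Set (L2per T) := {k | IsA q k 0}

/-- `w = 𝒜⁻¹ g`, where `𝒜⁻¹` is the inverse of `𝒜` on the orthogonal complement
of its kernel. -/
def IsAInv {T : ℝ} (q : ℝ → ℝ) (g w : L2per T) : Prop :=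
  IsA q w g ∧ ∀ k ∈ kerA q, inner ℝ w k = 0

/-- `s = ⟨e, (ℐ - κ ∂ₓ 𝒜⁻¹ ∂ₓ) e⟩`. When `ker 𝒜` is the line spanned by `e`, this is
the (one by one) matrix representation of `(ℐ - κ ∂ₓ 𝒜⁻¹ ∂ₓ)|_{ker 𝒜}` in the basis `e`. -/
def IsRestrictedEntry {T : ℝ} (q : ℝ → ℝ) (κ : ℝ) (e : L2per T) (s : ℝ) : Prop :=
  ∃ e' w v : L2per T, IsDeriv e e' ∧ IsAInv q e' w ∧ IsDeriv w v ∧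
    s = inner ℝ e (e - κ • v)

/-! ### The family of periodic waves -/

/-- The parameter space; the coordinates `0, 1, 2, 3` of a point are `a`, `E`, `c`, `b`. -/
abbrev Param : Type := Fin 4 → ℝ

/-- The effective potential `V(y) = -(a + c b) y - (1 - c²) y² / 2 + F(y)`. -/
def potential (F : ℝ → ℝ) (p : Param) (y : ℝ) : ℝ :=
  -(p 0 + p 2 * p 3) * y - (1 - p 2 ^ 2) / 2 * y ^ 2 + F y

/-- A family `u(x; a, E, c, b)` of nonconstant periodic solutions with energy `E` of the
travelling wave equation `-u'' + (1 - c²) u - f(u) = -(a + c b)`, depending smoothly on `x` and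
on the parameters in `Ω`. The choice of the translate `x ↦ x + ξ(a, E, c, b)` is arbitrary. -/
structure IsPeriodicWaveFamily (f F : ℝ → ℝ) (Ω : Set Param) (u : ℝ → Param → ℝ) : Prop where
  smooth : ContDiffOn ℝ ∞ (fun z : ℝ × Param => u z.1 z.2) (Set.univ ×ˢ Ω)
  ode : ∀ p ∈ Ω, ∀ x : ℝ,
    - deriv (deriv fun y => u y p) x + (1 - p 2 ^ 2) * u x p - f (u x p) = -(p 0 + p 2 * p 3)
  energy : ∀ p ∈ Ω, ∀ x : ℝ,
    1 / 2 * (deriv (fun y => u y p) x) ^ 2 + potential F p (u x p) = p 1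
  periodic : ∀ p ∈ Ω, ∃ τ : ℝ, 0 < τ ∧ Function.Periodic (fun x => u x p) τ
  nonconstant : ∀ p ∈ Ω, ∃ x y : ℝ, u x p ≠ u y p

/-- The period `T(a, E, c, b)` of the wave: the least positive period. -/
def period (u : ℝ → Param → ℝ) (p : Param) : ℝ :=
  sInf {τ : ℝ | 0 < τ ∧ Function.Periodic (fun x => u x p) τ}

/-- The second component `v = b - c u` of the wave. -/
def secondComponent (u : ℝ → Param → ℝ) (x : ℝ) (p : Param) : ℝ := p 3 - p 2 * u x p

/-- The first Casimir `M₁ = ∫₀ᵀ u dx` on the wave. -/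
def casimir₁ (u : ℝ → Param → ℝ) (p : Param) : ℝ :=
  ∫ x in (0 : ℝ)..period u p, u x p

/-- The momentum `P̃ = ∫₀ᵀ u v dx = -c ∫₀ᵀ u² dx + b M₁` on the wave. -/
def momentum (u : ℝ → Param → ℝ) (p : Param) : ℝ :=
  ∫ x in (0 : ℝ)..period u p, u x p * secondComponent u x p

/-- The second Casimir `M₂ = ∫₀ᵀ v dx = b T - c M₁` on the wave. -/
def casimir₂ (u : ℝ → Param → ℝ) (p : Param) : ℝ :=
  ∫ x in (0 : ℝ)..period u p, secondComponent u x p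

/-- The map `(a, E, c, b) ↦ (T, M₁, P̃, M₂)`. -/
def conserved (u : ℝ → Param → ℝ) (p : Param) : Fin 4 → ℝ :=
  ![period u p, casimir₁ u p, momentum u p, casimir₂ u p]

/-- The partial derivative of `g` at `p` with respect to the `i`-th parameter. -/
def pd (i : Fin 4) (g : Param → ℝ) (p : Param) : ℝ :=
  fderiv ℝ g p (Pi.single i 1)

/-- The determinant with rows `(T_a, M_{1,a})`, `(T_E, M_{1,E})`. -/
def det₂ (u : ℝ → Param → ℝ) (p : Param) : ℝ :=
  Matrix.det !![pd 0 (period u) p, pd 0 (casimir₁ u) p;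
                pd 1 (period u) p, pd 1 (casimir₁ u) p]

/-- The Jacobian determinant of `(T, M₁, P̃, M₂)` (columns) with respect to
`E, a, c, b` (rows, in this order). -/
def det₄ (u : ℝ → Param → ℝ) (p : Param) : ℝ :=
  Matrix.det
    !![pd 1 (period u) p, pd 1 (casimir₁ u) p, pd 1 (momentum u) p, pd 1 (casimir₂ u) p;
       pd 0 (period u) p, pd 0 (casimir₁ u) p, pd 0 (momentum u) p, pd 0 (casimir₂ u) p;
       pd 2 (period u) p, pd 2 (casimir₁ u) p, pd 2 (momentum u) p, pd 2 (casimir₂ u) p;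
       pd 3 (period u) p, pd 3 (casimir₁ u) p, pd 3 (momentum u) p, pd 3 (casimir₂ u) p]

/-- The potential `ĉ - f'(U)`, with `ĉ = 1 - c²`, of the Hill operator
`ℒ₂ = -∂ₓ² + ĉ - f'(U)` at the wave `U`. -/
def hillPotential (f : ℝ → ℝ) (u : ℝ → Param → ℝ) (p : Param) (x : ℝ) : ℝ :=
  (1 - p 2 ^ 2) - deriv f (u x p)

/-- `U - Ū`, the mean-zero part of the wave, as an element of `L²_per`. -/
def meanFree (u : ℝ → Param → ℝ) (p : Param) : L2per (period u p) :=
  toL2per (period u p) fun x => u x p - casimir₁ u p / period u p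

/-- `s` is the value of `(ℐ - 4 (1 - ĉ) ∂ₓ 𝒜⁻¹ ∂ₓ)|_{ker 𝒜}` at the wave with parameters `p`
in the basis `e` of `ker 𝒜`, where `ĉ = 1 - c²`. -/
def IsScalar (f : ℝ → ℝ) (u : ℝ → Param → ℝ) (p : Param) (e : L2per (period u p)) (s : ℝ) :
    Prop :=
  IsRestrictedEntry (hillPotential f u p) (4 * (1 - (1 - p 2 ^ 2))) e s

/-- `G` is a smooth diffeomorphism of an open neighbourhood of `p` inside `Ω` onto an open
neighbourhood of `G p`. -/
def IsLocalDiffeo (Ω : Set Param) (G : Param → Fin 4 → ℝ) (p : Param) : Prop :=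
  ∃ Φ : OpenPartialHomeomorph Param (Fin 4 → ℝ),
    p ∈ Φ.source ∧ Φ.source ⊆ Ω ∧ Set.EqOn Φ G Φ.source ∧
      ContDiffOn ℝ ∞ Φ Φ.source ∧ ContDiffOn ℝ ∞ Φ.symm Φ.target

end

end GoodBoussinesq

namespace GoodBoussinesq

open Set Filter Topology

/-! ### Integrals depending smoothly on parameters -/

section Parametric

variable {P : Type*} [NormedAddCommGroup P] [NormedSpace ℝ P]

/-! Put q = ĉ - f'(U) and N = ∫U² over a period. Differentiating the profile equation and the energy
identity in a parameter shows that each variation χ of the wave solves χ'' = qχ + A + CU and has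
Wronskian U'χ' - U''χ = e + AU + CU²/2, where e, A, C are the derivatives of E, a + cb and ĉ. Over
one period χ changes by minus the derivative of T times U'. So ∂_E u, with Wronskian 1, completes U'
to a fundamental pair, and variation of parameters gives ψ with ψ'' = qψ + U and Wronskian U²/2.
Modulo U', the c-variation is b ∂_a u - 2cψ and the b-variation is c ∂_a u; multiples of U' do not
affect the variations of T, M₁, N (`variation_eq`).

The kernel hypothesis enters twice. A combination α ∂_a u + β ∂_E u that fixes T and M₁ to first
order is periodic and mean-zero, and its antiderivative lies in ker 𝒜. Hence it is a multiple of U',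
its Wronskian αU + β vanishes, and α = β = 0; this is Δ ≠ 0 (`det_ne_zero`). Then ψ can be corrected
by such a combination to a periodic mean-zero v with v'' = qv + U + α. If W' = v then 𝒜W = U', and
𝒜⁻¹U' differs from W by a kernel element whose derivative is orthogonal to U - Ū. So S = N - M₁²/T -
4c²∫Uv (`isRestrictedEntry_iff`).

Finally, P̃ = bM₁ - cN and M₂ = bT - cM₁, so row and column operations bring J to block triangular
form with diagonal block determinants -Δ and T(4c²∫Uv - N) + M₁², whose product is TΔS. The Jacobian
of the parameter map is -J, and the inverse function theorem applies. Smoothness of T comes from the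
implicit function theorem (`contDiffAt_period`), that of the integrals from rescaling to a fixed
interval. -/

theorem contDiffOn_integral_zero_one {s : Set P} (hs : IsOpen s) {h : ℝ × P → ℝ}
    (hh : ContDiffOn ℝ ∞ h (univ ×ˢ s)) :
    ContDiffOn ℝ ∞ (fun p => ∫ t in (0 : ℝ)..1, h (t, p)) s := by
  -- The integral is the convolution, evaluated at 0, of the indicator of (0, 1] with y ↦ h(-y, p).
  -- The bump makes the second factor compactly supported and equals 1 on [-2, 2], which covers
  -- every -t with t in (0, 1].
  let χ : ContDiffBump (0 : ℝ) := ⟨2, 3, by norm_num, by norm_num⟩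
  let ind : ℝ → ℝ := indicator (Ioc (0 : ℝ) 1) 1
  let g : P → ℝ → ℝ := fun p y => χ y * h (-y, p)
  have hind : LocallyIntegrable ind volume := by
    apply Integrable.locallyIntegrable
    exact (integrable_indicator_iff measurableSet_Ioc).2
      (integrableOn_const (by simp) (by simp))
  have hg : ContDiffOn ℝ ∞ (fun z : P × ℝ => g z.1 z.2) (s ×ˢ univ) := by
    have h1 : ContDiff ℝ ∞ fun z : P × ℝ => χ z.2 := χ.contDiff.comp contDiff_snd
    have h2 : ContDiff ℝ ∞ fun z : P × ℝ => (-z.2, z.1) := by fun_prop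
    exact h1.contDiffOn.mul (hh.comp h2.contDiffOn fun z hz => ⟨mem_univ _, hz.1⟩)
  have key := contDiffOn_convolution_right_with_param_comp (μ := volume) (n := ⊤)
    (ContinuousLinearMap.lsmul ℝ ℝ) (s := s) (v := fun _ => (0 : ℝ)) contDiffOn_const
    (f := ind) (g := g) (k := Metric.closedBall 0 3) hs (isCompact_closedBall _ _)
    (fun p x _ hx => by
      have : χ x = 0 := χ.zero_of_le_dist (not_le.1 fun h => hx (Metric.mem_closedBall.2 h)).le
      simp [g, this]) hind hg
  refine key.congr fun p _ => ?_
  rw [convolution, intervalIntegral.integral_of_le zero_le_one, ← integral_indicator measurableSet_Ioc]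
  congr 1
  ext t
  by_cases ht : t ∈ Ioc (0 : ℝ) 1
  · have : χ (-t) = 1 := χ.one_of_mem_closedBall (by
      simp only [Metric.mem_closedBall, dist_zero_right, Real.norm_eq_abs, abs_neg]
      rw [abs_of_pos ht.1]
      exact ht.2.trans one_le_two)
    simp [ind, g, ht, this]
  · simp [ind, g, ht]

theorem integral_eq_mul_integral_zero_one (h : ℝ → ℝ) (t : ℝ) :
    ∫ x in (0 : ℝ)..t, h x = t * ∫ r in (0 : ℝ)..1, h (t * r) := by
  simp

/-- The substitution x = t r turns the variable endpoint into a parameter of the integrand. -/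
theorem contDiffOn_integral_left {s : Set P} (hs : IsOpen s) {g : ℝ × P → ℝ}
    (hg : ContDiffOn ℝ ∞ g (univ ×ˢ s)) :
    ContDiffOn ℝ ∞ (fun z : ℝ × P => ∫ x in (0 : ℝ)..z.1, g (x, z.2)) (univ ×ˢ s) := by
  have hS : IsOpen ((univ : Set ℝ) ×ˢ s) := isOpen_univ.prod hs
  have key := contDiffOn_integral_zero_one (h := fun w : ℝ × (ℝ × P) => g (w.2.1 * w.1, w.2.2)) hS
    ?_
  · exact (contDiff_fst.contDiffOn.mul key).congr fun z _ =>
      integral_eq_mul_integral_zero_one (fun x => g (x, z.2)) z.1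
  · have h2 : ContDiff ℝ ∞ fun w : ℝ × (ℝ × P) => (w.2.1 * w.1, w.2.2) := by fun_prop
    exact hg.comp h2.contDiffOn fun w hw => ⟨mem_univ _, hw.2.2⟩

theorem contDiffOn_integral_endpoint {s : Set P} (hs : IsOpen s) {g : ℝ × P → ℝ}
    (hg : ContDiffOn ℝ ∞ g (univ ×ˢ s)) {T : P → ℝ} (hT : ContDiffOn ℝ ∞ T s) :
    ContDiffOn ℝ ∞ (fun p => ∫ x in (0 : ℝ)..T p, g (x, p)) s :=
  (contDiffOn_integral_left hs hg).comp (hT.prodMk contDiffOn_id) fun _ hp => ⟨mem_univ _, hp⟩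

theorem hasDerivAt_line {g : ℝ × P → ℝ} {x : ℝ} {p v : P} {r : ℝ}
    (hg : DifferentiableAt ℝ g (x, p + r • v)) :
    HasDerivAt (fun r : ℝ => g (x, p + r • v)) (fderiv ℝ g (x, p + r • v) (0, v)) r := by
  have h1 : HasDerivAt (fun r : ℝ => (x, p + r • v)) (0, v) r := by
    refine (hasDerivAt_const r x).prodMk ?_
    simpa using ((hasDerivAt_id r).smul_const v).const_add p
  exact hg.hasFDerivAt.comp_hasDerivAt r h1

theorem hasDerivAt_integral_line {s : Set P} (hs : IsOpen s) {g : ℝ × P → ℝ}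
    (hg : ContDiffOn ℝ ∞ g (univ ×ˢ s)) (t : ℝ) {p : P} (hp : p ∈ s) (v : P) :
    HasDerivAt (fun r : ℝ => ∫ x in (0 : ℝ)..t, g (x, p + r • v))
      (∫ x in (0 : ℝ)..t, fderiv ℝ g (x, p) (0, v)) 0 := by
  have hS : IsOpen ((univ : Set ℝ) ×ˢ s) := isOpen_univ.prod hs
  have hline : Continuous fun r : ℝ => p + r • v := by fun_prop
  obtain ⟨ε, hε, hball⟩ : ∃ ε > 0, ∀ r ∈ Metric.closedBall (0 : ℝ) ε, p + r • v ∈ s := by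
    have : (fun r : ℝ => p + r • v) ⁻¹' s ∈ 𝓝 (0 : ℝ) :=
      hline.continuousAt.preimage_mem_nhds (hs.mem_nhds (by simpa using hp))
    exact Metric.nhds_basis_closedBall.mem_iff.1 this
  have hdg : ContinuousOn (fderiv ℝ g) (univ ×ˢ s) := hg.continuousOn_fderiv_of_isOpen hS (by simp)
  have hF' : ContinuousOn (fun z : ℝ × ℝ => fderiv ℝ g (z.1, p + z.2 • v) (0, v))
      (univ ×ˢ Metric.closedBall (0 : ℝ) ε) := by
    refine ContinuousOn.clm_apply (hdg.comp (f := fun z : ℝ × ℝ => (z.1, p + z.2 • v)) (by fun_prop) fun z hz => ⟨mem_univ _, hball _ hz.2⟩)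
      continuousOn_const
  -- Compactness of the product of the integration interval and the parameter ball supplies a
  -- constant dominating function.
  obtain ⟨C, hC⟩ := ((isCompact_uIcc (a := (0 : ℝ)) (b := t)).prod
    (isCompact_closedBall (0 : ℝ) ε)).exists_bound_of_continuousOn
    (hF'.mono (prod_mono (subset_univ _) subset_rfl))
  have hcont : ∀ r ∈ Metric.closedBall (0 : ℝ) ε, Continuous fun x => g (x, p + r • v) := fun r hr =>
    hg.continuousOn.comp_continuous (by fun_prop) fun x => ⟨mem_univ _, hball r hr⟩
  have h0 : (0 : ℝ) ∈ Metric.closedBall (0 : ℝ) ε := Metric.mem_closedBall_self hε.le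
  have key := intervalIntegral.hasDerivAt_integral_of_dominated_loc_of_deriv_le (μ := volume)
    (F := fun r x => g (x, p + r • v))
    (F' := fun r x => fderiv ℝ g (x, p + r • v) (0, v)) (x₀ := (0 : ℝ))
    (s := Metric.closedBall (0 : ℝ) ε) (a := 0) (b := t) (bound := fun _ => C)
    (Metric.closedBall_mem_nhds _ hε) ?_ ((hcont 0 h0).intervalIntegrable _ _) ?_ ?_
    intervalIntegrable_const ?_
  · simpa using key.2
  · filter_upwards [Metric.closedBall_mem_nhds (0 : ℝ) hε] with r hr
    exact (hcont r hr).aestronglyMeasurable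
  · refine Continuous.aestronglyMeasurable (continuousOn_univ.1 ?_)
    exact hF'.comp (f := fun x : ℝ => (x, (0 : ℝ))) (by fun_prop) fun x _ => ⟨mem_univ x, h0⟩
  · refine Eventually.of_forall fun x hx r hr => hC (x, r) ⟨uIoc_subset_uIcc hx, hr⟩
  · refine Eventually.of_forall fun x _ r hr => hasDerivAt_line ?_
    exact ((hg _ ⟨mem_univ _, hball r hr⟩).contDiffAt
      (hS.mem_nhds ⟨mem_univ _, hball r hr⟩)).differentiableAt (by simp)

theorem fderiv_integral_endpoint {s : Set P} (hs : IsOpen s) {g : ℝ × P → ℝ}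
    (hg : ContDiffOn ℝ ∞ g (univ ×ˢ s)) {T : P → ℝ} {p : P} (hp : p ∈ s)
    (hT : DifferentiableAt ℝ T p) (v : P) :
    fderiv ℝ (fun p => ∫ x in (0 : ℝ)..T p, g (x, p)) p v =
      (∫ x in (0 : ℝ)..T p, fderiv ℝ g (x, p) (0, v)) + fderiv ℝ T p v * g (T p, p) := by
  let G : ℝ × P → ℝ := fun z => ∫ x in (0 : ℝ)..z.1, g (x, z.2)
  have hS : IsOpen ((univ : Set ℝ) ×ˢ s) := isOpen_univ.prod hs
  have hmem : (T p, p) ∈ (univ : Set ℝ) ×ˢ s := ⟨mem_univ _, hp⟩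
  have hG : DifferentiableAt ℝ G (T p, p) :=
    ((contDiffOn_integral_left hs hg _ hmem).contDiffAt (hS.mem_nhds hmem)).differentiableAt
      (by simp)
  have hcomp : fderiv ℝ (fun p => ∫ x in (0 : ℝ)..T p, g (x, p)) p v
      = fderiv ℝ G (T p, p) (fderiv ℝ T p v, v) := by
    have := (HasFDerivAt.comp (f := fun p => (T p, p)) p hG.hasFDerivAt (hT.hasFDerivAt.prodMk (hasFDerivAt_id p))).fderiv
    exact congrArg (fun A => A v) this
  have hv : fderiv ℝ G (T p, p) (0, v) = ∫ x in (0 : ℝ)..T p, fderiv ℝ g (x, p) (0, v) := by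
    have h1 := hasDerivAt_line (g := G) (x := T p) (p := p) (v := v) (r := 0) (by simpa using hG)
    simpa using h1.unique (hasDerivAt_integral_line hs hg (T p) hp v)
  have ht : fderiv ℝ G (T p, p) (1, 0) = g (T p, p) := by
    have h1 : HasDerivAt (fun t : ℝ => (t, p)) ((1 : ℝ), (0 : P)) (T p) :=
      (hasDerivAt_id _).prodMk (hasDerivAt_const _ _)
    have h2 : HasDerivAt (fun t => G (t, p)) (fderiv ℝ G (T p, p) (1, 0)) (T p) :=
      HasFDerivAt.comp_hasDerivAt (l := G) (f := fun t => (t, p)) (T p) hG.hasFDerivAt h1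
    have hc : Continuous fun x => g (x, p) :=
      hg.continuousOn.comp_continuous (by fun_prop) fun x => ⟨mem_univ _, hp⟩
    exact h2.unique (intervalIntegral.integral_hasDerivAt_right (hc.intervalIntegrable _ _)
      (hc.stronglyMeasurableAtFilter _ _) hc.continuousAt)
  have hsplit : ((fderiv ℝ T p v, v) : ℝ × P) = (0, v) + fderiv ℝ T p v • ((1 : ℝ), (0 : P)) := by
    simp
  rw [hcomp, hsplit, map_add, map_smul, hv, ht, smul_eq_mul]

end Parametric

/-! ### Periods of scalar functions and uniqueness for Newton's equation -/

/-- Global uniqueness needs only a Lipschitz bound on the strip |position| ≤ R containing both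
orbits; the field is linear in the velocity, which may stay unrestricted. -/
theorem eq_of_newton {W : ℝ → ℝ} (hW : ContDiff ℝ 1 W) {u v u' v' : ℝ → ℝ} {R : ℝ}
    (hu : ∀ x, HasDerivAt u (u' x) x) (hu' : ∀ x, HasDerivAt u' (W (u x)) x)
    (hv : ∀ x, HasDerivAt v (v' x) x) (hv' : ∀ x, HasDerivAt v' (W (v x)) x)
    (hubd : ∀ x, |u x| ≤ R) (hvbd : ∀ x, |v x| ≤ R) {x₀ : ℝ}
    (h0 : u x₀ = v x₀) (h1 : u' x₀ = v' x₀) : u = v := by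
  obtain ⟨K, hK⟩ := LocallyLipschitzOn.exists_lipschitzOnWith_of_compact
    (isCompact_closedBall (0 : ℝ) R) (hW.locallyLipschitz.locallyLipschitzOn)
  let s : Set (ℝ × ℝ) := {z | z.1 ∈ Metric.closedBall (0 : ℝ) R}
  let field : ℝ → ℝ × ℝ → ℝ × ℝ := fun _ z => (z.2, W z.1)
  have hfield : ∀ t, LipschitzOnWith (max (1 : NNReal) (K * 1)) (field t) s := fun t =>
    (LipschitzWith.prod_snd.lipschitzOnWith (s := s)).prodMk
      (hK.comp (LipschitzWith.prod_fst.lipschitzOnWith (s := s)) fun z hz => hz)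
  have key := ODE_solution_unique_univ (v := field) (s := fun _ => s)
    (f := fun x => (u x, u' x)) (g := fun x => (v x, v' x)) (t₀ := x₀) hfield
    (fun t => ⟨(hu t).prodMk (hu' t), by simpa [s] using hubd t⟩)
    (fun t => ⟨(hv t).prodMk (hv' t), by simpa [s] using hvbd t⟩) (by simp [h0, h1])
  funext x
  exact congrArg Prod.fst (congrFun key x)

theorem exists_abs_le_of_periodic {g : ℝ → ℝ} (hg : Continuous g) {τ : ℝ} (hτ : 0 < τ)
    (hper : Function.Periodic g τ) : ∃ R, ∀ x, |g x| ≤ R := by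
  obtain ⟨R, hR⟩ := (isCompact_Icc (a := (0 : ℝ)) (b := τ)).exists_bound_of_continuousOn
    hg.continuousOn
  refine ⟨R, fun x => ?_⟩
  obtain ⟨y, hy, hxy⟩ := hper.exists_mem_Ico₀ hτ x
  rw [hxy]
  exact hR y ⟨hy.1, hy.2.le⟩

/-- By Rolle, a period τ ≤ δ would produce a critical point in the window. -/
theorem not_periodic_of_deriv_ne_zero {g : ℝ → ℝ} (hg : Continuous g) {x₀ δ : ℝ}
    (hδ : ∀ x ∈ Icc x₀ (x₀ + δ), deriv g x ≠ 0) {τ : ℝ} (h0 : 0 < τ) (h1 : τ ≤ δ) :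
    ¬ Function.Periodic g τ := fun h => by
  obtain ⟨c, hc, hc'⟩ := exists_deriv_eq_zero (f := g) (lt_add_of_pos_right x₀ h0)
    hg.continuousOn (h x₀).symm
  exact hδ c ⟨hc.1.le, hc.2.le.trans (by linarith)⟩ hc'

theorem exists_deriv_ne_zero {g : ℝ → ℝ} (hg : Differentiable ℝ g) {x y : ℝ} (h : g x ≠ g y) :
    ∃ x₀, deriv g x₀ ≠ 0 := by
  by_contra! H
  exact h (is_const_of_deriv_eq_zero hg H x y)

/-- A window where the derivative does not vanish keeps positive periods above some δ > 0, so the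
set of positive periods is closed and its infimum is attained. -/
theorem isLeast_sInf_periods {g : ℝ → ℝ} (hg : ContDiff ℝ 1 g) {τ : ℝ} (hτ : 0 < τ)
    (hper : Function.Periodic g τ) {x y : ℝ} (hxy : g x ≠ g y) :
    IsLeast {τ : ℝ | 0 < τ ∧ Function.Periodic g τ}
      (sInf {τ : ℝ | 0 < τ ∧ Function.Periodic g τ}) := by
  obtain ⟨x₀, hx₀⟩ := exists_deriv_ne_zero (hg.differentiable one_ne_zero) hxy
  obtain ⟨δ, hδ, hball⟩ := Metric.nhds_basis_closedBall.mem_iff.1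
    ((hg.continuous_deriv le_rfl).continuousAt.eventually_ne hx₀)
  have hno : ∀ τ, 0 < τ → Function.Periodic g τ → δ ≤ τ := fun τ h0 hp => by
    by_contra! hlt
    refine not_periodic_of_deriv_ne_zero hg.continuous (x₀ := x₀) (δ := δ) (fun x hx => ?_)
      h0 hlt.le hp
    refine hball (a := x) ?_
    rw [Metric.mem_closedBall, Real.dist_eq, abs_of_nonneg (by linarith [hx.1])]
    linarith [hx.2]
  have hEq : {τ : ℝ | 0 < τ ∧ Function.Periodic g τ} =
      Ici δ ∩ ⋂ x, {τ : ℝ | g (x + τ) = g x} := by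
    ext τ
    simp only [mem_ofPred_eq, mem_inter_iff, mem_Ici, mem_iInter]
    exact ⟨fun h => ⟨hno τ h.1 h.2, h.2⟩, fun h => ⟨hδ.trans_le h.1, h.2⟩⟩
  have hclosed : IsClosed {τ : ℝ | 0 < τ ∧ Function.Periodic g τ} := by
    rw [hEq]
    refine isClosed_Ici.inter (isClosed_iInter fun x => isClosed_eq ?_ continuous_const)
    exact hg.continuous.comp (by fun_prop)
  have hbdd : BddBelow {τ : ℝ | 0 < τ ∧ Function.Periodic g τ} := ⟨0, fun τ h => h.1.le⟩
  exact ⟨hclosed.csInf_mem ⟨τ, hτ, hper⟩ hbdd, fun τ h => csInf_le hbdd h⟩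

/-! ### The wave as a function of position and parameters -/

/-- The wave as a function of `(x, p)`. -/
def wave (u : ℝ → Param → ℝ) (z : ℝ × Param) : ℝ := u z.1 z.2

/-- The spatial derivative of a function of `(x, p)`. -/
noncomputable def dx (g : ℝ × Param → ℝ) (z : ℝ × Param) : ℝ := fderiv ℝ g z (1, 0)

/-- The derivative of a function of `(x, p)` with respect to the parameter `i`. -/
noncomputable def dp (i : Fin 4) (g : ℝ × Param → ℝ) (z : ℝ × Param) : ℝ :=
  fderiv ℝ g z (0, Pi.single i 1)

section Derivatives

variable {Ω : Set Param} {g h : ℝ × Param → ℝ}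

theorem contDiffOn_fderiv_apply (hΩ : IsOpen Ω) (hg : ContDiffOn ℝ ∞ g (univ ×ˢ Ω))
    (v : ℝ × Param) : ContDiffOn ℝ ∞ (fun z => fderiv ℝ g z v) (univ ×ˢ Ω) :=
  (hg.fderiv_of_isOpen (isOpen_univ.prod hΩ) (m := ∞) (by simp)).clm_apply contDiffOn_const

theorem contDiffOn_dx (hΩ : IsOpen Ω) (hg : ContDiffOn ℝ ∞ g (univ ×ˢ Ω)) :
    ContDiffOn ℝ ∞ (dx g) (univ ×ˢ Ω) :=
  contDiffOn_fderiv_apply hΩ hg _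

theorem contDiffOn_dp (hΩ : IsOpen Ω) (hg : ContDiffOn ℝ ∞ g (univ ×ˢ Ω)) (i : Fin 4) :
    ContDiffOn ℝ ∞ (dp i g) (univ ×ˢ Ω) :=
  contDiffOn_fderiv_apply hΩ hg _

theorem contDiffAt_of_param (hΩ : IsOpen Ω) (hg : ContDiffOn ℝ ∞ g (univ ×ˢ Ω)) {p : Param}
    (hp : p ∈ Ω) (x : ℝ) : ContDiffAt ℝ ∞ g (x, p) :=
  (hg _ ⟨mem_univ x, hp⟩).contDiffAt ((isOpen_univ.prod hΩ).mem_nhds ⟨mem_univ x, hp⟩)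

theorem differentiableAt_of_param (hΩ : IsOpen Ω) (hg : ContDiffOn ℝ ∞ g (univ ×ˢ Ω)) {p : Param}
    (hp : p ∈ Ω) (x : ℝ) : DifferentiableAt ℝ g (x, p) :=
  (contDiffAt_of_param hΩ hg hp x).differentiableAt (by simp)

theorem contDiff_slice (hg : ContDiffOn ℝ ∞ g (univ ×ˢ Ω)) {p : Param} (hp : p ∈ Ω) :
    ContDiff ℝ ∞ fun x => g (x, p) :=
  contDiffOn_univ.1 (hg.comp (f := fun x : ℝ => (x, p)) (by fun_prop) fun x _ => ⟨mem_univ x, hp⟩)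

theorem hasDerivAt_slice (hΩ : IsOpen Ω) (hg : ContDiffOn ℝ ∞ g (univ ×ˢ Ω)) {p : Param}
    (hp : p ∈ Ω) (x : ℝ) : HasDerivAt (fun x => g (x, p)) (dx g (x, p)) x :=
  HasFDerivAt.comp_hasDerivAt (l := g) (f := fun x : ℝ => (x, p)) x
    (differentiableAt_of_param hΩ hg hp x).hasFDerivAt ((hasDerivAt_id x).prodMk (hasDerivAt_const x p))

theorem deriv_slice (hΩ : IsOpen Ω) (hg : ContDiffOn ℝ ∞ g (univ ×ˢ Ω)) {p : Param}
    (hp : p ∈ Ω) : deriv (fun x => g (x, p)) = fun x => dx g (x, p) :=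
  funext fun x => (hasDerivAt_slice hΩ hg hp x).deriv

theorem fderiv_fderiv_apply (hΩ : IsOpen Ω) (hg : ContDiffOn ℝ ∞ g (univ ×ˢ Ω)) {p : Param}
    (hp : p ∈ Ω) (x : ℝ) (v w : ℝ × Param) :
    fderiv ℝ (fun z => fderiv ℝ g z v) (x, p) w = fderiv ℝ (fderiv ℝ g) (x, p) w v := by
  have h := contDiffAt_of_param hΩ hg hp x
  have hd : DifferentiableAt ℝ (fderiv ℝ g) (x, p) :=
    (h.fderiv_right (m := 1) (by norm_cast)).differentiableAt one_ne_zero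
  rw [fderiv_clm_apply hd (differentiableAt_const v)]
  simp

theorem dp_dx (hΩ : IsOpen Ω) (hg : ContDiffOn ℝ ∞ g (univ ×ˢ Ω)) {p : Param} (hp : p ∈ Ω)
    (i : Fin 4) (x : ℝ) : dp i (dx g) (x, p) = dx (dp i g) (x, p) := by
  have hsymm := (contDiffAt_of_param hΩ hg hp x).isSymmSndFDerivAt (n := ∞)
    (by rw [minSmoothness_of_isRCLikeNormedField]; norm_cast)
  exact (fderiv_fderiv_apply hΩ hg hp x _ _).trans
    ((hsymm _ _).trans (fderiv_fderiv_apply hΩ hg hp x _ _).symm)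

theorem dx_congr (hΩ : IsOpen Ω) (hgh : EqOn g h (univ ×ˢ Ω)) {p : Param} (hp : p ∈ Ω)
    (x : ℝ) : dx g (x, p) = dx h (x, p) := by
  have : g =ᶠ[𝓝 (x, p)] h :=
    hgh.eventuallyEq_of_mem ((isOpen_univ.prod hΩ).mem_nhds ⟨mem_univ x, hp⟩)
  simp only [dx, this.fderiv_eq]

end Derivatives

/-! ### Profile equation, energy and least period at a fixed parameter -/

namespace IsPeriodicWaveFamily

variable {f F : ℝ → ℝ} {Ω : Set Param} {u : ℝ → Param → ℝ}

theorem smooth_wave (hu : IsPeriodicWaveFamily f F Ω u) :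
    ContDiffOn ℝ ∞ (wave u) (univ ×ˢ Ω) := hu.smooth

theorem ode_wave (hu : IsPeriodicWaveFamily f F Ω u) (hΩ : IsOpen Ω) {p : Param} (hp : p ∈ Ω)
    (x : ℝ) : dx (dx (wave u)) (x, p) =
      (p 0 + p 2 * p 3) + (1 - p 2 ^ 2) * wave u (x, p) - f (wave u (x, p)) := by
  have h := hu.ode p hp x
  have h1 : (deriv fun y => u y p) = fun x => dx (wave u) (x, p) :=
    deriv_slice hΩ hu.smooth_wave hp
  rw [h1, deriv_slice hΩ (contDiffOn_dx hΩ hu.smooth_wave) hp] at h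
  simp only [wave] at *
  linarith

theorem energy_wave (hu : IsPeriodicWaveFamily f F Ω u) (hΩ : IsOpen Ω) {p : Param} (hp : p ∈ Ω)
    (x : ℝ) : 1 / 2 * dx (wave u) (x, p) ^ 2 + potential F p (wave u (x, p)) = p 1 := by
  have h := hu.energy p hp x
  have h1 : (deriv fun y => u y p) = fun x => dx (wave u) (x, p) :=
    deriv_slice hΩ hu.smooth_wave hp
  rwa [h1] at h

theorem isLeast_period (hu : IsPeriodicWaveFamily f F Ω u) {p : Param} (hp : p ∈ Ω) :
    IsLeast {τ : ℝ | 0 < τ ∧ Function.Periodic (fun x => u x p) τ} (period u p) := by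
  obtain ⟨τ, hτ, hper⟩ := hu.periodic p hp
  obtain ⟨x, y, hxy⟩ := hu.nonconstant p hp
  exact isLeast_sInf_periods ((contDiff_slice hu.smooth_wave hp).of_le (by simp)) hτ hper hxy

theorem period_pos (hu : IsPeriodicWaveFamily f F Ω u) {p : Param} (hp : p ∈ Ω) :
    0 < period u p := (hu.isLeast_period hp).1.1

theorem periodic_period (hu : IsPeriodicWaveFamily f F Ω u) {p : Param} (hp : p ∈ Ω) :
    Function.Periodic (fun x => wave u (x, p)) (period u p) := (hu.isLeast_period hp).1.2

/-- The profile equation is autonomous, so a return to the same position and velocity is a period.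
-/
theorem eq_shift (hu : IsPeriodicWaveFamily f F Ω u) (hf : ContDiff ℝ ∞ f) (hΩ : IsOpen Ω)
    {p : Param} (hp : p ∈ Ω) {x₀ τ : ℝ} (h0 : wave u (x₀ + τ, p) = wave u (x₀, p))
    (h1 : dx (wave u) (x₀ + τ, p) = dx (wave u) (x₀, p)) :
    Function.Periodic (fun x => u x p) τ := by
  obtain ⟨R, hR⟩ := exists_abs_le_of_periodic (contDiff_slice hu.smooth_wave hp).continuous
    (hu.period_pos hp) (hu.periodic_period hp)
  have hW : ContDiff ℝ 1 fun y => (p 0 + p 2 * p 3) + (1 - p 2 ^ 2) * y - f y := by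
    have : ContDiff ℝ 1 f := hf.of_le (by simp)
    fun_prop
  have hd := hasDerivAt_slice hΩ hu.smooth_wave hp
  have hd2 : ∀ x, HasDerivAt (fun x => dx (wave u) (x, p))
      ((p 0 + p 2 * p 3) + (1 - p 2 ^ 2) * wave u (x, p) - f (wave u (x, p))) x := fun x => by
    rw [← hu.ode_wave hΩ hp]
    exact hasDerivAt_slice hΩ (contDiffOn_dx hΩ hu.smooth_wave) hp x
  exact fun x => congrFun (eq_of_newton hW (fun x => (hd (x + τ)).comp_add_const x τ)
    (fun x => (hd2 (x + τ)).comp_add_const x τ) hd hd2 (fun x => hR _) hR h0 h1) x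

end IsPeriodicWaveFamily

/-! ### Smooth dependence of the least period on the parameters -/

theorem isInvertible_of_apply_one_ne_zero {A : ℝ →L[ℝ] ℝ} (hA : A 1 ≠ 0) : A.IsInvertible := by
  refine ⟨ContinuousLinearEquiv.unitsEquivAut ℝ (Units.mk0 (A 1) hA), ?_⟩
  ext
  simp

theorem periodic_deriv {g : ℝ → ℝ} {τ : ℝ} (hg : Function.Periodic g τ) :
    Function.Periodic (deriv g) τ := fun x => by
  rw [← deriv_comp_add_const]
  exact congrArg (fun h => deriv h x) (funext hg)

namespace IsPeriodicWaveFamily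

variable {f F : ℝ → ℝ} {Ω : Set Param} {u : ℝ → Param → ℝ}

/-- Small periods are excluded by a derivative that is nonzero on a window uniform in p. On the
remaining compact range [δ, τ₁] failure of periodicity is an open condition in (p, τ), so it
persists uniformly near p₀. -/
theorem eventually_not_periodic (hu : IsPeriodicWaveFamily f F Ω u) (hΩ : IsOpen Ω)
    {p₀ : Param} (hp₀ : p₀ ∈ Ω) {x₀ : ℝ} (hx₀ : dx (wave u) (x₀, p₀) ≠ 0) {τ₁ : ℝ}
    (hτ₁ : τ₁ < period u p₀) :
    ∀ᶠ p in 𝓝 p₀, ∀ τ, 0 < τ → τ ≤ τ₁ → ¬ Function.Periodic (fun x => u x p) τ := by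
  have hcdx : ContinuousAt (dx (wave u)) (x₀, p₀) :=
    (contDiffAt_of_param hΩ (contDiffOn_dx hΩ hu.smooth_wave) hp₀ x₀).continuousAt
  obtain ⟨δ, hδ, hsmall⟩ : ∃ δ > 0, ∀ᶠ p in 𝓝 p₀, ∀ τ, 0 < τ → τ ≤ δ →
      ¬ Function.Periodic (fun x => u x p) τ := by
    have h1 := hcdx.eventually_ne hx₀
    rw [nhds_prod_eq] at h1
    obtain ⟨s, hs, t, ht, hst⟩ := mem_prod_iff.1 h1
    obtain ⟨δ, hδ, hball⟩ := Metric.nhds_basis_closedBall.mem_iff.1 hs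
    refine ⟨δ, hδ, ?_⟩
    filter_upwards [ht, hΩ.mem_nhds hp₀] with p hpt hp τ h0 h1
    refine not_periodic_of_deriv_ne_zero (x₀ := x₀) (δ := δ)
      (contDiff_slice hu.smooth_wave hp).continuous (fun x hx => ?_) h0 h1
    have hxs : x ∈ s := hball (by
      rw [Metric.mem_closedBall, Real.dist_eq, abs_of_nonneg (by linarith [hx.1])]
      linarith [hx.2])
    rw [deriv_slice hΩ hu.smooth_wave hp]
    exact hst (mk_mem_prod hxs hpt)
  have hlarge : ∀ᶠ p in 𝓝 p₀, ∀ τ ∈ Icc δ τ₁, ¬ Function.Periodic (fun x => u x p) τ := by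
    refine isCompact_Icc.eventually_forall_of_forall_eventually
      (P := fun p τ => ¬ Function.Periodic (fun x => u x p) τ) fun τ hτ => ?_
    have hnot : ¬ Function.Periodic (fun x => u x p₀) τ := fun h =>
      absurd ((hu.isLeast_period hp₀).2 ⟨hδ.trans_le hτ.1, h⟩) (by linarith [hτ.2])
    obtain ⟨x, hx⟩ := not_forall.1 hnot
    have hc : ∀ y, ContinuousAt (wave u) (y, p₀) := fun y =>
      (contDiffAt_of_param hΩ hu.smooth_wave hp₀ y).continuousAt
    have h1 : ContinuousAt (fun z : Param × ℝ => wave u (x + z.2, z.1)) (p₀, τ) :=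
      ContinuousAt.comp (g := wave u) (f := fun z : Param × ℝ => (x + z.2, z.1)) (x := (p₀, τ))
        (hc (x + τ)) (by fun_prop)
    have h2 : ContinuousAt (fun z : Param × ℝ => wave u (x, z.1)) (p₀, τ) :=
      ContinuousAt.comp (g := wave u) (f := fun z : Param × ℝ => (x, z.1)) (x := (p₀, τ))
        (hc x) (by fun_prop)
    filter_upwards [h1.ne_iff_eventually_ne h2 |>.1 hx] with z hz hper
    exact hz (hper x)
  filter_upwards [hsmall, hlarge] with p h1 h2 τ h0 hle
  rcases le_total τ δ with h | h
  · exact h1 τ h0 h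
  · exact h2 τ ⟨h, hle⟩

/-- The implicit function theorem solves u(ψ(p), p) = u(x₀, p) near x₀ + T₀, at a point where u' ≠
0. The rest shows that ψ(p) - x₀ is a period and that it is the least one for p near p₀. -/
theorem contDiffAt_period (hu : IsPeriodicWaveFamily f F Ω u) (hf : ContDiff ℝ ∞ f)
    (hΩ : IsOpen Ω) {p₀ : Param} (hp₀ : p₀ ∈ Ω) : ContDiffAt ℝ ∞ (period u) p₀ := by
  set T₀ := period u p₀ with hT₀
  have hT₀pos : 0 < T₀ := hu.period_pos hp₀
  have hw := hu.smooth_wave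
  obtain ⟨x₀, hx₀⟩ : ∃ x₀, dx (wave u) (x₀, p₀) ≠ 0 := by
    obtain ⟨x, y, hxy⟩ := hu.nonconstant p₀ hp₀
    obtain ⟨x₀, h⟩ := exists_deriv_ne_zero
      ((contDiff_slice hw hp₀).differentiable (by simp)) (x := x) (y := y) hxy
    exact ⟨x₀, by rwa [deriv_slice hΩ hw hp₀] at h⟩
  have hper₀ := hu.periodic_period hp₀
  have hdxT : dx (wave u) (x₀ + T₀, p₀) = dx (wave u) (x₀, p₀) := by
    have := periodic_deriv hper₀
    rw [deriv_slice hΩ hw hp₀] at this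
    exact this x₀
  let φ : Param × ℝ → ℝ := fun z => wave u (z.2, z.1) - wave u (x₀, z.1)
  have hφ : ContDiffAt ℝ ∞ φ (p₀, x₀ + T₀) := by
    refine ContDiffAt.sub ?_ ?_
    · exact ContDiffAt.comp (f := fun z : Param × ℝ => (z.2, z.1)) (p₀, x₀ + T₀)
        (contDiffAt_of_param hΩ hw hp₀ _) (by fun_prop)
    · exact ContDiffAt.comp (f := fun z : Param × ℝ => (x₀, z.1)) (p₀, x₀ + T₀)
        (contDiffAt_of_param hΩ hw hp₀ _) (by fun_prop)
  have hφ0 : φ (p₀, x₀ + T₀) = 0 := sub_eq_zero.2 (hper₀ x₀)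
  have hinv : (fderiv ℝ φ (p₀, x₀ + T₀) ∘L .inr ℝ Param ℝ).IsInvertible := by
    refine isInvertible_of_apply_one_ne_zero ?_
    have h1 : HasDerivAt (fun y => φ (p₀, y)) (fderiv ℝ φ (p₀, x₀ + T₀) (0, 1)) (x₀ + T₀) :=
      HasFDerivAt.comp_hasDerivAt (l := φ) (f := fun y : ℝ => (p₀, y)) _
        (hφ.differentiableAt (by simp)).hasFDerivAt
        ((hasDerivAt_const _ p₀).prodMk (hasDerivAt_id _))
    have h2 : HasDerivAt (fun y => φ (p₀, y)) (dx (wave u) (x₀ + T₀, p₀)) (x₀ + T₀) :=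
      (hasDerivAt_slice hΩ hw hp₀ (x₀ + T₀)).sub_const (wave u (x₀, p₀))
    have : fderiv ℝ φ (p₀, x₀ + T₀) (0, 1) ≠ 0 := by rw [h1.unique h2, hdxT]; exact hx₀
    simpa using this
  let ψ : Param → ℝ := hφ.implicitFunction (by simp) hinv
  have hψ : ContDiffAt ℝ ∞ ψ p₀ := hφ.contDiffAt_implicitFunction (by simp) hinv
  have hψ0 : ψ p₀ = x₀ + T₀ := hφ.implicitFunction_apply_self (by simp) hinv
  have hψeq : ∀ᶠ p in 𝓝 p₀, φ (p, ψ p) = 0 := by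
    have := hφ.eventually_apply_implicitFunction (by simp) hinv
    rw [hφ0] at this
    exact this
  have hψc := hψ.continuousAt
  have hcdx : ∀ y, ContinuousAt (dx (wave u)) (y, p₀) := fun y =>
    (contDiffAt_of_param hΩ (contDiffOn_dx hΩ hw) hp₀ y).continuousAt
  have hsign : ∀ᶠ p in 𝓝 p₀, 0 < dx (wave u) (ψ p, p) * dx (wave u) (x₀, p) := by
    have h1 : ContinuousAt (fun p => dx (wave u) (ψ p, p)) p₀ :=
      ContinuousAt.comp (f := fun p => (ψ p, p)) (hcdx _) (by fun_prop)
    have h2 : ContinuousAt (fun p => dx (wave u) (x₀, p)) p₀ :=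
      ContinuousAt.comp (f := fun p : Param => (x₀, p)) (hcdx _) (by fun_prop)
    refine (h1.mul h2).eventually_const_lt ?_
    rw [Pi.mul_apply, hψ0, hdxT]
    exact mul_self_pos.2 hx₀
  have hlow : ∀ᶠ p in 𝓝 p₀, T₀ / 2 < ψ p - x₀ :=
    (hψc.sub continuousAt_const).eventually_const_lt (by simp [hψ0]; linarith)
  have hupp : ∀ᶠ p in 𝓝 p₀, ψ p - x₀ < 5 / 4 * T₀ :=
    (hψc.sub continuousAt_const).eventually_lt_const (by simp [hψ0]; linarith)
  have hno := hu.eventually_not_periodic hΩ hp₀ hx₀ (τ₁ := 3 / 4 * T₀) (by linarith)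
  refine (hψ.sub (contDiffAt_const (c := x₀))).congr_of_eventuallyEq ?_
  filter_upwards [hψeq, hsign, hlow, hupp, hno, hΩ.mem_nhds hp₀] with p h1 h2 h3 h4 h5 hp
  have hval : wave u (x₀ + (ψ p - x₀), p) = wave u (x₀, p) := by
    rw [add_sub_cancel]; exact sub_eq_zero.1 h1
  have hder : dx (wave u) (x₀ + (ψ p - x₀), p) = dx (wave u) (x₀, p) := by
    have e1 := hu.energy_wave hΩ hp (x₀ + (ψ p - x₀))
    have e2 := hu.energy_wave hΩ hp x₀
    rw [hval] at e1
    -- Equal energies at equal positions leave the velocity determined up to sign; the opposite sign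
    -- contradicts the positive product `hsign`.
    rcases sq_eq_sq_iff_eq_or_eq_neg.1 (show dx (wave u) (x₀ + (ψ p - x₀), p) ^ 2
      = dx (wave u) (x₀, p) ^ 2 by linarith) with h | h
    · exact h
    · rw [add_sub_cancel] at h
      rw [h] at h2
      nlinarith [mul_self_nonneg (dx (wave u) (x₀, p))]
  have hper := hu.eq_shift hf hΩ hp hval hder
  have hle : period u p ≤ ψ p - x₀ := (hu.isLeast_period hp).2 ⟨by linarith, hper⟩
  have hgt : 3 / 4 * T₀ < period u p := by
    by_contra! hcon
    exact h5 _ (hu.period_pos hp) hcon (hu.periodic_period hp)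
  -- A smaller least period would differ from ψ(p) - x₀ by a positive period below 5T₀/4 - 3T₀/4 =
  -- T₀/2, which `hno` forbids.
  by_contra hne
  exact h5 (ψ p - x₀ - period u p) (sub_pos.2 (lt_of_le_of_ne hle hne)) (by linarith)
    (hper.sub_period (hu.periodic_period hp))

theorem contDiffOn_period (hu : IsPeriodicWaveFamily f F Ω u) (hf : ContDiff ℝ ∞ f)
    (hΩ : IsOpen Ω) : ContDiffOn ℝ ∞ (period u) Ω := fun _ hp =>
  (hu.contDiffAt_period hf hΩ hp).contDiffWithinAt

end IsPeriodicWaveFamily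

/-- The integral of `u²` over one period. -/
noncomputable def secondMoment (u : ℝ → Param → ℝ) (p : Param) : ℝ :=
  ∫ x in (0 : ℝ)..period u p, u x p ^ 2

/-! ### Derivatives along parameter directions -/

theorem hasDerivAt_param_line {G : Param → ℝ} {p : Param} (hG : DifferentiableAt ℝ G p)
    (i : Fin 4) :
    HasDerivAt (fun r : ℝ => G (p + r • Pi.single i 1)) (pd i G p) 0 := by
  have h1 : HasDerivAt (fun r : ℝ => p + r • (Pi.single i 1 : Param)) (Pi.single i 1) 0 := by
    simpa using ((hasDerivAt_id (0 : ℝ)).smul_const (Pi.single i 1 : Param)).const_add p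
  refine HasFDerivAt.comp_hasDerivAt (l := G) (f := fun r : ℝ => p + r • (Pi.single i 1 : Param)) 0
    ?_ h1
  simpa using hG.hasFDerivAt

theorem hasDerivAt_dp {Ω : Set Param} (hΩ : IsOpen Ω) {g : ℝ × Param → ℝ}
    (hg : ContDiffOn ℝ ∞ g (univ ×ˢ Ω)) {p : Param} (hp : p ∈ Ω) (i : Fin 4) (x : ℝ) :
    HasDerivAt (fun r : ℝ => g (x, p + r • Pi.single i 1)) (dp i g (x, p)) 0 := by
  have := hasDerivAt_line (g := g) (x := x) (p := p) (v := Pi.single i 1) (r := 0)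
    (by simpa using differentiableAt_of_param hΩ hg hp x)
  simpa [dp] using this

theorem eventually_line_mem {Ω : Set Param} (hΩ : IsOpen Ω) {p : Param} (hp : p ∈ Ω)
    (v : Param) : ∀ᶠ r : ℝ in 𝓝 0, p + r • v ∈ Ω := by
  have hc : Continuous fun r : ℝ => p + r • v := by fun_prop
  exact hc.continuousAt.preimage_mem_nhds (hΩ.mem_nhds (by simpa using hp))

theorem pd_coord_mul {G : Param → ℝ} {p : Param} (hG : DifferentiableAt ℝ G p) (i j : Fin 4) :
    pd i (fun p => p j * G p) p = (Pi.single i 1 : Param) j * G p + p j * pd i G p := by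
  have hj : HasFDerivAt (fun p : Param => p j) (ContinuousLinearMap.proj (R := ℝ) j) p :=
    (ContinuousLinearMap.proj (R := ℝ) (φ := fun _ : Fin 4 => ℝ) j).hasFDerivAt
  have := (hj.mul hG.hasFDerivAt).fderiv
  simp only [pd]
  rw [show (fun p : Param => p j * G p) = (fun p : Param => p j) * G from rfl, this]
  simp
  ring

theorem differentiableAt_coord_mul {G : Param → ℝ} {p : Param} (hG : DifferentiableAt ℝ G p)
    (j : Fin 4) : DifferentiableAt ℝ (fun p => p j * G p) p := by fun_prop

theorem pd_sub {G H : Param → ℝ} {p : Param} (hG : DifferentiableAt ℝ G p)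
    (hH : DifferentiableAt ℝ H p) (i : Fin 4) :
    pd i (fun p => G p - H p) p = pd i G p - pd i H p := by
  simp only [pd]
  rw [show (fun p : Param => G p - H p) = G - H from rfl, fderiv_sub hG hH]
  simp

theorem pd_congr {Ω : Set Param} (hΩ : IsOpen Ω) {G H : Param → ℝ} (h : EqOn G H Ω) {p : Param}
    (hp : p ∈ Ω) (i : Fin 4) : pd i G p = pd i H p := by
  simp only [pd, (h.eventuallyEq_of_mem (hΩ.mem_nhds hp)).fderiv_eq]

/-! ### Variations of the wave and of its conserved quantities -/

namespace IsPeriodicWaveFamily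

variable {f F : ℝ → ℝ} {Ω : Set Param} {u : ℝ → Param → ℝ}

theorem differentiableAt_period (hu : IsPeriodicWaveFamily f F Ω u) (hf : ContDiff ℝ ∞ f)
    (hΩ : IsOpen Ω) {p : Param} (hp : p ∈ Ω) : DifferentiableAt ℝ (period u) p :=
  (hu.contDiffAt_period hf hΩ hp).differentiableAt (by simp)

theorem dp_ode (hu : IsPeriodicWaveFamily f F Ω u) (hf : ContDiff ℝ ∞ f) (hΩ : IsOpen Ω)
    {p : Param} (hp : p ∈ Ω) (i : Fin 4) {A C : ℝ}
    (hA : pd i (fun p => p 0 + p 2 * p 3) p = A) (hC : pd i (fun p => 1 - p 2 ^ 2) p = C) (x : ℝ) :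
    dx (dx (dp i (wave u))) (x, p) =
      A + C * u x p + hillPotential f u p x * dp i (wave u) (x, p) := by
  have hw := hu.smooth_wave
  have h1 := hasDerivAt_dp hΩ (contDiffOn_dx hΩ (contDiffOn_dx hΩ hw)) hp i x
  have h2 : HasDerivAt (fun r : ℝ => f (wave u (x, p + r • Pi.single i 1)))
      (deriv f (u x p) * dp i (wave u) (x, p)) 0 := by
    have hfd : HasDerivAt f (deriv f (u x p)) (wave u (x, p + (0 : ℝ) • Pi.single i 1)) := by
      simpa [wave] using (hf.differentiable (by simp) _).hasDerivAt
    exact hfd.comp 0 (hasDerivAt_dp hΩ hw hp i x)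
  have hA' := hasDerivAt_param_line (G := fun p => p 0 + p 2 * p 3) (p := p) (by fun_prop) i
  have hC' := hasDerivAt_param_line (G := fun p => 1 - p 2 ^ 2) (p := p) (by fun_prop) i
  rw [hA] at hA'
  rw [hC] at hC'
  have h3 := (hA'.add (hC'.mul (hasDerivAt_dp hΩ hw hp i x))).sub h2
  have h4 := h1.unique (h3.congr_of_eventuallyEq (by
    filter_upwards [eventually_line_mem hΩ hp (Pi.single i 1)] with r hr
    exact hu.ode_wave hΩ hr x))
  have hswap : dx (dx (dp i (wave u))) (x, p) = dp i (dx (dx (wave u))) (x, p) := by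
    rw [dp_dx hΩ (contDiffOn_dx hΩ hw) hp]
    exact (dx_congr hΩ (fun z hz => dp_dx hΩ hw hz.2 i z.1) hp x).symm
  rw [hswap, h4]
  simp [wave, hillPotential]
  ring

/-- The position derivative of the potential along the wave is -U'', so linearising the energy
identity in a parameter produces the Wronskian of U' with the variation. -/
theorem dp_energy (hu : IsPeriodicWaveFamily f F Ω u) (hF : ∀ y : ℝ, HasDerivAt F (f y) y)
    (hΩ : IsOpen Ω) {p : Param} (hp : p ∈ Ω) (i : Fin 4) {A C E : ℝ}
    (hA : pd i (fun p => p 0 + p 2 * p 3) p = A) (hC : pd i (fun p => 1 - p 2 ^ 2) p = C)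
    (hE : pd i (fun p => p 1) p = E) (x : ℝ) :
    dx (wave u) (x, p) * dx (dp i (wave u)) (x, p) -
      dx (dx (wave u)) (x, p) * dp i (wave u) (x, p) = E + A * u x p + C / 2 * u x p ^ 2 := by
  have hw := hu.smooth_wave
  have h0 := hasDerivAt_dp hΩ hw hp i x
  have h1 := hasDerivAt_dp hΩ (contDiffOn_dx hΩ hw) hp i x
  have h2 : HasDerivAt (fun r : ℝ => F (wave u (x, p + r • Pi.single i 1)))
      (f (u x p) * dp i (wave u) (x, p)) 0 := by
    have hfd : HasDerivAt F (f (u x p)) (wave u (x, p + (0 : ℝ) • Pi.single i 1)) := by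
      simpa [wave] using hF (u x p)
    exact hfd.comp 0 h0
  have hA' := hasDerivAt_param_line (G := fun p => p 0 + p 2 * p 3) (p := p) (by fun_prop) i
  have hC' := hasDerivAt_param_line (G := fun p => 1 - p 2 ^ 2) (p := p) (by fun_prop) i
  have hE' := hasDerivAt_param_line (G := fun p => p 1) (p := p) (by fun_prop) i
  rw [hA] at hA'
  rw [hC] at hC'
  rw [hE] at hE'
  have h3 := ((h1.pow 2).const_mul (1 / 2)).add
    ((((hA'.neg.mul h0).sub ((hC'.div_const 2).mul (h0.pow 2))).add h2))
  have h4 := hE'.unique (h3.congr_of_eventuallyEq (by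
    filter_upwards [eventually_line_mem hΩ hp (Pi.single i 1)] with r hr
    exact (hu.energy_wave hΩ hr x).symm))
  have h5 := hu.ode_wave hΩ hp x
  rw [dp_dx hΩ hw hp] at h4
  rw [h5]
  simp [wave] at h4 ⊢
  linarith

/-- Obtained by differentiating u(x + T(p), p) = u(x, p) in the parameter: variations fail to be
periodic exactly through the variation of T. -/
theorem dp_shift (hu : IsPeriodicWaveFamily f F Ω u) (hf : ContDiff ℝ ∞ f) (hΩ : IsOpen Ω)
    {p : Param} (hp : p ∈ Ω) (i : Fin 4) (x : ℝ) :
    dp i (wave u) (x + period u p, p) =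
      dp i (wave u) (x, p) - pd i (period u) p * dx (wave u) (x, p) := by
  have hw := hu.smooth_wave
  have hT := hasDerivAt_param_line (hu.differentiableAt_period hf hΩ hp) i
  have h1 : HasDerivAt (fun r : ℝ => p + r • (Pi.single i 1 : Param)) (Pi.single i 1) 0 := by
    simpa using ((hasDerivAt_id (0 : ℝ)).smul_const (Pi.single i 1 : Param)).const_add p
  have h2 : HasDerivAt (fun r : ℝ => wave u
      (x + period u (p + r • Pi.single i 1), p + r • Pi.single i 1))
      (fderiv ℝ (wave u) (x + period u p, p) (pd i (period u) p, Pi.single i 1)) 0 := by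
    refine HasFDerivAt.comp_hasDerivAt (l := wave u)
      (f := fun r : ℝ => (x + period u (p + r • Pi.single i 1), p + r • (Pi.single i 1 : Param))) 0
      ?_ ((hT.const_add x).prodMk h1)
    simpa using (differentiableAt_of_param hΩ hw hp (x + period u p)).hasFDerivAt
  have h3 := h2.unique ((hasDerivAt_dp hΩ hw hp i x).congr_of_eventuallyEq (by
    filter_upwards [eventually_line_mem hΩ hp (Pi.single i 1)] with r hr
    exact hu.periodic_period hr x))
  have hdx : dx (wave u) (x + period u p, p) = dx (wave u) (x, p) := by
    have := periodic_deriv (hu.periodic_period hp)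
    rw [deriv_slice hΩ hw hp] at this
    exact this x
  have hsplit : ((pd i (period u) p, Pi.single i 1) : ℝ × Param) =
      (0, Pi.single i 1) + pd i (period u) p • ((1 : ℝ), (0 : Param)) := by simp
  rw [hsplit, map_add, map_smul] at h3
  simp only [dp, dx, smul_eq_mul] at h3 hdx ⊢
  rw [← hdx]
  linarith

theorem wave_period (hu : IsPeriodicWaveFamily f F Ω u) {p : Param} (hp : p ∈ Ω) :
    u (period u p) p = u 0 p := by
  simpa [wave] using hu.periodic_period hp 0

theorem contDiffOn_casimir₁ (hu : IsPeriodicWaveFamily f F Ω u) (hf : ContDiff ℝ ∞ f)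
    (hΩ : IsOpen Ω) : ContDiffOn ℝ ∞ (casimir₁ u) Ω :=
  contDiffOn_integral_endpoint hΩ hu.smooth_wave (hu.contDiffOn_period hf hΩ)

theorem contDiffOn_secondMoment (hu : IsPeriodicWaveFamily f F Ω u) (hf : ContDiff ℝ ∞ f)
    (hΩ : IsOpen Ω) : ContDiffOn ℝ ∞ (secondMoment u) Ω :=
  contDiffOn_integral_endpoint hΩ (hu.smooth_wave.pow 2) (hu.contDiffOn_period hf hΩ)

theorem pd_casimir₁ (hu : IsPeriodicWaveFamily f F Ω u) (hf : ContDiff ℝ ∞ f)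
    (hΩ : IsOpen Ω) {p : Param} (hp : p ∈ Ω) (i : Fin 4) :
    pd i (casimir₁ u) p =
      (∫ x in (0 : ℝ)..period u p, dp i (wave u) (x, p)) + pd i (period u) p * u 0 p := by
  rw [← hu.wave_period hp]
  exact fderiv_integral_endpoint hΩ hu.smooth_wave hp (hu.differentiableAt_period hf hΩ hp) _

theorem pd_secondMoment (hu : IsPeriodicWaveFamily f F Ω u) (hf : ContDiff ℝ ∞ f)
    (hΩ : IsOpen Ω) {p : Param} (hp : p ∈ Ω) (i : Fin 4) :
    pd i (secondMoment u) p =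
      (∫ x in (0 : ℝ)..period u p, 2 * (u x p * dp i (wave u) (x, p))) +
        pd i (period u) p * u 0 p ^ 2 := by
  rw [← hu.wave_period hp]
  have h := fderiv_integral_endpoint hΩ (hu.smooth_wave.pow 2) hp
    (hu.differentiableAt_period hf hΩ hp) (Pi.single i 1)
  refine h.trans ?_
  congr 1
  refine intervalIntegral.integral_congr fun x _ => ?_
  have := ((differentiableAt_of_param hΩ hu.smooth_wave hp x).hasFDerivAt.pow 2).fderiv
  rw [show (fun z => wave u z ^ 2) = wave u ^ 2 from rfl] at this
  erw [this]
  simp [dp, wave]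
  ring

theorem momentum_eq (hu : IsPeriodicWaveFamily f F Ω u) {p : Param} (hp : p ∈ Ω) :
    momentum u p = p 3 * casimir₁ u p - p 2 * secondMoment u p := by
  have hc : Continuous fun x => u x p := (contDiff_slice hu.smooth_wave hp).continuous
  simp only [momentum, casimir₁, secondMoment, secondComponent]
  rw [← intervalIntegral.integral_const_mul, ← intervalIntegral.integral_const_mul,
    ← intervalIntegral.integral_sub]
  · exact intervalIntegral.integral_congr fun x _ => by ring
  · exact (continuous_const.mul hc).intervalIntegrable _ _
  · exact (continuous_const.mul (hc.pow 2)).intervalIntegrable _ _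

theorem casimir₂_eq (hu : IsPeriodicWaveFamily f F Ω u) {p : Param} (hp : p ∈ Ω) :
    casimir₂ u p = p 3 * period u p - p 2 * casimir₁ u p := by
  have hc : Continuous fun x => u x p := (contDiff_slice hu.smooth_wave hp).continuous
  simp only [casimir₂, casimir₁, secondComponent]
  rw [intervalIntegral.integral_sub intervalIntegrable_const
    (Continuous.intervalIntegrable (by fun_prop) _ _), intervalIntegral.integral_const_mul]
  simp
  ring

theorem contDiffOn_conserved (hu : IsPeriodicWaveFamily f F Ω u) (hf : ContDiff ℝ ∞ f)
    (hΩ : IsOpen Ω) : ContDiffOn ℝ ∞ (conserved u) Ω := by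
  have hc : ∀ j : Fin 4, ContDiffOn ℝ ∞ (fun p : Param => p j) Ω := fun j => by fun_prop
  have hT := hu.contDiffOn_period hf hΩ
  have hM := hu.contDiffOn_casimir₁ hf hΩ
  have hN := hu.contDiffOn_secondMoment hf hΩ
  rw [contDiffOn_pi]
  intro j
  fin_cases j
  · exact hT
  · exact hM
  · exact (((hc 3).mul hM).sub ((hc 2).mul hN)).congr fun p hp => hu.momentum_eq hp
  · exact (((hc 3).mul hT).sub ((hc 2).mul hM)).congr fun p hp => hu.casimir₂_eq hp

theorem pd_momentum (hu : IsPeriodicWaveFamily f F Ω u) (hf : ContDiff ℝ ∞ f)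
    (hΩ : IsOpen Ω) {p : Param} (hp : p ∈ Ω) (i : Fin 4) :
    pd i (momentum u) p =
      (Pi.single i 1 : Param) 3 * casimir₁ u p + p 3 * pd i (casimir₁ u) p -
        ((Pi.single i 1 : Param) 2 * secondMoment u p + p 2 * pd i (secondMoment u) p) := by
  have hM := ((hu.contDiffOn_casimir₁ hf hΩ).contDiffAt (hΩ.mem_nhds hp)).differentiableAt
    (by simp)
  have hN := ((hu.contDiffOn_secondMoment hf hΩ).contDiffAt (hΩ.mem_nhds hp)).differentiableAt
    (by simp)
  rw [pd_congr hΩ (fun p hp => hu.momentum_eq hp) hp,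
    pd_sub (differentiableAt_coord_mul hM 3) (differentiableAt_coord_mul hN 2),
    pd_coord_mul hM, pd_coord_mul hN]

theorem pd_casimir₂ (hu : IsPeriodicWaveFamily f F Ω u) (hf : ContDiff ℝ ∞ f)
    (hΩ : IsOpen Ω) {p : Param} (hp : p ∈ Ω) (i : Fin 4) :
    pd i (casimir₂ u) p =
      (Pi.single i 1 : Param) 3 * period u p + p 3 * pd i (period u) p -
        ((Pi.single i 1 : Param) 2 * casimir₁ u p + p 2 * pd i (casimir₁ u) p) := by
  have hM := ((hu.contDiffOn_casimir₁ hf hΩ).contDiffAt (hΩ.mem_nhds hp)).differentiableAt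
    (by simp)
  have hT := hu.differentiableAt_period hf hΩ hp
  rw [pd_congr hΩ (fun p hp => hu.casimir₂_eq hp) hp,
    pd_sub (differentiableAt_coord_mul hT 3) (differentiableAt_coord_mul hM 2),
    pd_coord_mul hT, pd_coord_mul hM]

end IsPeriodicWaveFamily

theorem pd_coord (i j : Fin 4) (p : Param) :
    pd i (fun p => p j) p = (Pi.single i 1 : Param) j := by
  have := pd_coord_mul (G := fun _ => 1) (p := p) (by fun_prop) i j
  simpa [pd] using this

theorem pd_force (i : Fin 4) (p : Param) :
    pd i (fun p => p 0 + p 2 * p 3) p = (Pi.single i 1 : Param) 0 +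
      ((Pi.single i 1 : Param) 2 * p 3 + p 2 * (Pi.single i 1 : Param) 3) := by
  have h := pd_coord_mul (G := fun p => p 3) (p := p) (by fun_prop) i 2
  rw [pd_coord] at h
  rw [← h, ← pd_coord i 0 p]
  simp only [pd]
  rw [show (fun p : Param => p 0 + p 2 * p 3) = (fun p : Param => p 0) + fun p => p 2 * p 3 from rfl,
    fderiv_add (by fun_prop) (by fun_prop)]
  simp

theorem pd_speed (i : Fin 4) (p : Param) :
    pd i (fun p => 1 - p 2 ^ 2) p = -(2 * p 2 * (Pi.single i 1 : Param) 2) := by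
  have h := pd_coord_mul (G := fun p => p 2) (p := p) (by fun_prop) i 2
  rw [pd_coord] at h
  rw [show (fun p : Param => 1 - p 2 ^ 2) = fun p => 1 - p 2 * p 2 by funext p; ring,
    pd_sub (by fun_prop) (by fun_prop), h]
  simp [pd]
  ring

/-! ### Inhomogeneous solutions of Hill's equation -/

/-- `h` is a smooth solution of `h'' = q h + g`. -/
def HillSolves (q g h : ℝ → ℝ) : Prop :=
  ContDiff ℝ ∞ h ∧ ∀ x, deriv (deriv h) x = q x * h x + g x

/-- The Wronskian of `U'` and `h`. -/
noncomputable def wronskian (U h : ℝ → ℝ) (x : ℝ) : ℝ :=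
  deriv U x * deriv h x - deriv (deriv U) x * h x

theorem contDiff_deriv {h : ℝ → ℝ} (hh : ContDiff ℝ ∞ h) : ContDiff ℝ ∞ (deriv h) :=
  (contDiff_infty_iff_deriv.1 hh).2

theorem hasDerivAt_of_smooth {h : ℝ → ℝ} (hh : ContDiff ℝ ∞ h) (x : ℝ) :
    HasDerivAt h (deriv h x) x :=
  (hh.differentiable (by simp) x).hasDerivAt

theorem deriv_comb {h k : ℝ → ℝ} (hh : ContDiff ℝ ∞ h) (hk : ContDiff ℝ ∞ k) (a b : ℝ) :
    deriv (fun x => a * h x + b * k x) = fun x => a * deriv h x + b * deriv k x :=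
  funext fun x => (((hasDerivAt_of_smooth hh x).const_mul a).add
    ((hasDerivAt_of_smooth hk x).const_mul b)).deriv

theorem HillSolves.comb {q g₁ g₂ h k : ℝ → ℝ} (hh : HillSolves q g₁ h) (hk : HillSolves q g₂ k)
    (a b : ℝ) :
    HillSolves q (fun x => a * g₁ x + b * g₂ x) (fun x => a * h x + b * k x) := by
  refine ⟨(contDiff_const.mul hh.1).add (contDiff_const.mul hk.1), fun x => ?_⟩
  rw [deriv_comb hh.1 hk.1, deriv_comb (contDiff_deriv hh.1) (contDiff_deriv hk.1)]
  simp only [hh.2, hk.2]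
  ring

theorem wronskian_comb {U h k : ℝ → ℝ} (hh : ContDiff ℝ ∞ h) (hk : ContDiff ℝ ∞ k) (a b x : ℝ) :
    wronskian U (fun x => a * h x + b * k x) x = a * wronskian U h x + b * wronskian U k x := by
  simp only [wronskian, deriv_comb hh hk]
  ring

/-- The variation of `∫₀ᵀ U` in the direction `h`, when the variation of the period is `t`. -/
noncomputable def massVar (T : ℝ) (U h : ℝ → ℝ) (t : ℝ) : ℝ :=
  (∫ x in (0 : ℝ)..T, h x) + t * U 0

/-- The variation of `∫₀ᵀ U²` in the direction `h`, when the variation of the period is `t`. -/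
noncomputable def squareVar (T : ℝ) (U h : ℝ → ℝ) (t : ℝ) : ℝ :=
  (∫ x in (0 : ℝ)..T, 2 * (U x * h x)) + t * U 0 ^ 2

theorem massVar_comb {T : ℝ} {U h k : ℝ → ℝ} (hh : ContDiff ℝ ∞ h) (hk : ContDiff ℝ ∞ k)
    (a b t s : ℝ) : massVar T U (fun x => a * h x + b * k x) (a * t + b * s) =
      a * massVar T U h t + b * massVar T U k s := by
  have hh' := hh.continuous
  have hk' := hk.continuous
  simp only [massVar]
  rw [intervalIntegral.integral_add (Continuous.intervalIntegrable (by fun_prop) _ _)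
    (Continuous.intervalIntegrable (by fun_prop) _ _), intervalIntegral.integral_const_mul,
    intervalIntegral.integral_const_mul]
  ring

theorem squareVar_comb {T : ℝ} {U h k : ℝ → ℝ} (hU : ContDiff ℝ ∞ U) (hh : ContDiff ℝ ∞ h)
    (hk : ContDiff ℝ ∞ k) (a b t s : ℝ) :
    squareVar T U (fun x => a * h x + b * k x) (a * t + b * s) =
      a * squareVar T U h t + b * squareVar T U k s := by
  have hU' := hU.continuous
  have hh' := hh.continuous
  have hk' := hk.continuous
  simp only [squareVar]
  rw [show (fun x => 2 * (U x * (a * h x + b * k x))) =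
      fun x => a * (2 * (U x * h x)) + b * (2 * (U x * k x)) by funext x; ring]
  rw [intervalIntegral.integral_add (Continuous.intervalIntegrable (by fun_prop) _ _)
    (Continuous.intervalIntegrable (by fun_prop) _ _), intervalIntegral.integral_const_mul a,
    intervalIntegral.integral_const_mul b]
  ring

/-- A nonconstant periodic wave `U` with `U''' = q U'`, and its variations `y` in the energy and
`φ` in the constant of integration. Over a period they change by multiples of `U'`. -/
structure WaveVariation (T : ℝ) (q U y φ : ℝ → ℝ) (tE ta : ℝ) : Prop where
  period_pos : 0 < T
  periodic_q : Function.Periodic q T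
  smooth_wave : ContDiff ℝ ∞ U
  periodic_wave : Function.Periodic U T
  nonconstant : ∃ x z, U x ≠ U z
  solves_deriv : HillSolves q (fun _ => 0) (deriv U)
  solves_energy : HillSolves q (fun _ => 0) y
  wronskian_energy : ∀ x, wronskian U y x = 1
  shift_energy : ∀ x, y (x + T) = y x - tE * deriv U x
  solves_force : HillSolves q (fun _ => 1) φ
  wronskian_force : ∀ x, wronskian U φ x = U x
  shift_force : ∀ x, φ (x + T) = φ x - ta * deriv U x

/-- The mean-zero periodic solutions of `h'' = q h + const` are the multiples of `U'`. -/
def KernelIsLine (T : ℝ) (q U : ℝ → ℝ) : Prop :=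
  ∀ (h : ℝ → ℝ) (k : ℝ), HillSolves q (fun _ => k) h → Function.Periodic h T →
    ∫ x in (0 : ℝ)..T, h x = 0 → ∃ κ, ∀ x, h x = κ * deriv U x

namespace WaveVariation

variable {T : ℝ} {q U y φ : ℝ → ℝ} {tE ta : ℝ}

/-- The factor is h y' - h' y, constant because h and y solve the same homogeneous equation. Since
U' and y have Wronskian 1, vanishing of the Wronskian of U' and h removes the y component. -/
theorem eq_mul_deriv (H : WaveVariation T q U y φ tE ta) {h : ℝ → ℝ}
    (hh : HillSolves q (fun _ => 0) h) (hw : ∀ x, wronskian U h x = 0) :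
    ∃ α, ∀ x, h x = α * deriv U x := by
  have hder : ∀ x, HasDerivAt (fun x => h x * deriv y x - deriv h x * y x) 0 x := fun x => by
    have h1 := ((hasDerivAt_of_smooth hh.1 x).mul
        (hasDerivAt_of_smooth (contDiff_deriv H.solves_energy.1) x)).sub
      ((hasDerivAt_of_smooth (contDiff_deriv hh.1) x).mul
        (hasDerivAt_of_smooth H.solves_energy.1 x))
    refine h1.congr_deriv ?_
    rw [hh.2, H.solves_energy.2]
    ring
  have hconst : ∀ x, h x * deriv y x - deriv h x * y x = h 0 * deriv y 0 - deriv h 0 * y 0 :=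
    fun x => is_const_of_deriv_eq_zero (fun x => (hder x).differentiableAt)
      (fun x => (hder x).deriv) x 0
  refine ⟨h 0 * deriv y 0 - deriv h 0 * y 0, fun x => ?_⟩
  have h1 := H.wronskian_energy x
  have h2 := hw x
  simp only [wronskian] at h1 h2
  rw [← hconst x]
  linear_combination (-h x) * h1 + y x * h2

theorem integral_deriv (H : WaveVariation T q U y φ tE ta) :
    ∫ x in (0 : ℝ)..T, deriv U x = 0 := by
  rw [intervalIntegral.integral_deriv_eq_sub
    (fun x _ => (hasDerivAt_of_smooth H.smooth_wave x).differentiableAt)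
    ((contDiff_deriv H.smooth_wave).continuous.intervalIntegrable _ _)]
  have := H.periodic_wave 0
  simp at this
  simp [this]

theorem integral_mul_deriv (H : WaveVariation T q U y φ tE ta) :
    ∫ x in (0 : ℝ)..T, 2 * (U x * deriv U x) = 0 := by
  have hd : ∀ x, HasDerivAt (fun x => U x ^ 2) (2 * (U x * deriv U x)) x := fun x =>
    ((hasDerivAt_of_smooth H.smooth_wave x).pow 2).congr_deriv (by simp; ring)
  have h1 := H.smooth_wave.continuous
  have h2 := (contDiff_deriv H.smooth_wave).continuous
  rw [intervalIntegral.integral_eq_sub_of_hasDerivAt (fun x _ => hd x)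
    (Continuous.intervalIntegrable (by fun_prop) _ _)]
  have := H.periodic_wave 0
  simp at this
  simp [this]

theorem exists_deriv_ne_zero (H : WaveVariation T q U y φ tE ta) : ∃ x, deriv U x ≠ 0 := by
  obtain ⟨x, z, h⟩ := H.nonconstant
  exact GoodBoussinesq.exists_deriv_ne_zero (H.smooth_wave.differentiable (by simp)) h

/-- The first condition makes αφ + βy periodic and the second makes it mean-zero, so it is a
multiple of U'. Its Wronskian αU + β then vanishes identically, and U is not constant. -/
theorem coeff_eq_zero (H : WaveVariation T q U y φ tE ta) (hK : KernelIsLine T q U) {α β : ℝ}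
    (ht : α * ta + β * tE = 0) (hm : α * massVar T U φ ta + β * massVar T U y tE = 0) :
    α = 0 ∧ β = 0 := by
  have hsol := H.solves_force.comb H.solves_energy α β
  have hper : Function.Periodic (fun x => α * φ x + β * y x) T := fun x => by
    simp only [H.shift_force, H.shift_energy]
    linear_combination (-deriv U x) * ht
  have hmean : ∫ x in (0 : ℝ)..T, α * φ x + β * y x = 0 := by
    have := massVar_comb (T := T) (U := U) H.solves_force.1 H.solves_energy.1 α β ta tE
    rw [ht, hm] at this
    simpa [massVar] using this
  obtain ⟨κ, hκ⟩ := hK _ (α * 1 + β * 0) hsol hper hmean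
  have hzero : ∀ x, α * U x + β = 0 := fun x => by
    have h1 := wronskian_comb (U := U) H.solves_force.1 H.solves_energy.1 α β x
    rw [H.wronskian_force, H.wronskian_energy] at h1
    have h2 : (fun x => α * φ x + β * y x) = fun x => κ * deriv U x + 0 * deriv U x := by
      funext x; rw [hκ]; ring
    rw [h2, wronskian_comb (contDiff_deriv H.smooth_wave)
      (contDiff_deriv H.smooth_wave)] at h1
    simp only [wronskian] at h1
    linarith
  obtain ⟨x, z, hxz⟩ := H.nonconstant
  have hα : α = 0 := by
    have : α * (U x - U z) = 0 := by linarith [hzero x, hzero z]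
    exact (mul_eq_zero.1 this).resolve_right (sub_ne_zero.2 hxz)
  refine ⟨hα, ?_⟩
  have := hzero x
  rw [hα] at this
  linarith

theorem det_ne_zero (H : WaveVariation T q U y φ tE ta) (hK : KernelIsLine T q U) :
    ta * massVar T U y tE - massVar T U φ ta * tE ≠ 0 := fun h => by
  -- If the determinant vanished, the period and mass rows would each give a null vector, forcing
  -- all four entries to be zero; then (1, 0) would be a null vector as well.
  obtain ⟨h1, h2⟩ := H.coeff_eq_zero hK (α := tE) (β := -ta) (by ring) (by linarith)
  obtain ⟨h3, h4⟩ := H.coeff_eq_zero hK (α := massVar T U y tE) (β := -massVar T U φ ta)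
    (by linarith) (by ring)
  exact one_ne_zero (H.coeff_eq_zero hK (α := 1) (β := 0) (by linarith) (by linarith)).1

/-- A solution of `h'' = q h + U`. -/
noncomputable def particular (U y : ℝ → ℝ) (x : ℝ) : ℝ :=
  y x * (U x ^ 2 / 2) - deriv U x * ∫ r in (0 : ℝ)..x, y r * U r

theorem hasDerivAt_particular (H : WaveVariation T q U y φ tE ta) (x : ℝ) :
    HasDerivAt (particular U y)
      (deriv y x * (U x ^ 2 / 2) - deriv (deriv U) x * ∫ r in (0 : ℝ)..x, y r * U r) x := by
  have hc : Continuous fun r => y r * U r :=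
    H.solves_energy.1.continuous.mul H.smooth_wave.continuous
  have hI : HasDerivAt (fun x => ∫ r in (0 : ℝ)..x, y r * U r) (y x * U x) x :=
    intervalIntegral.integral_hasDerivAt_right (hc.intervalIntegrable _ _)
      (hc.stronglyMeasurableAtFilter _ _) hc.continuousAt
  have h1 := ((hasDerivAt_of_smooth H.solves_energy.1 x).mul
      (((hasDerivAt_of_smooth H.smooth_wave x).pow 2).div_const 2)).sub
    ((hasDerivAt_of_smooth (contDiff_deriv H.smooth_wave) x).mul hI)
  refine h1.congr_deriv ?_
  simp
  ring

theorem deriv_particular (H : WaveVariation T q U y φ tE ta) :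
    deriv (particular U y) = fun x =>
      deriv y x * (U x ^ 2 / 2) - deriv (deriv U) x * ∫ r in (0 : ℝ)..x, y r * U r :=
  funext fun x => (H.hasDerivAt_particular x).deriv

/-- `particular` is variation of parameters for the pair U', y. Taking U²/2, without a constant, as
primitive of UU' gives the Wronskian the form that occurs for the variation in c. -/
theorem wronskian_particular (H : WaveVariation T q U y φ tE ta) (x : ℝ) :
    wronskian U (particular U y) x = U x ^ 2 / 2 := by
  have := H.wronskian_energy x
  simp only [wronskian, H.deriv_particular, particular] at this ⊢
  linear_combination (U x ^ 2 / 2) * this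

theorem solves_particular (H : WaveVariation T q U y φ tE ta) :
    HillSolves q U (particular U y) := by
  have hc : ContDiff ℝ ∞ fun r => y r * U r := H.solves_energy.1.mul H.smooth_wave
  have hI : ∀ x, HasDerivAt (fun x => ∫ r in (0 : ℝ)..x, y r * U r) (y x * U x) x := fun x =>
    intervalIntegral.integral_hasDerivAt_right (hc.continuous.intervalIntegrable _ _)
      (hc.continuous.stronglyMeasurableAtFilter _ _) hc.continuous.continuousAt
  have hIs : ContDiff ℝ ∞ fun x => ∫ r in (0 : ℝ)..x, y r * U r := by
    rw [contDiff_infty_iff_deriv]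
    refine ⟨fun x => (hI x).differentiableAt, ?_⟩
    rwa [show (deriv fun x => ∫ r in (0 : ℝ)..x, y r * U r) = fun x => y x * U x from
      funext fun x => (hI x).deriv]
  refine ⟨(H.solves_energy.1.mul ((H.smooth_wave.pow 2).div_const 2)).sub
    ((contDiff_deriv H.smooth_wave).mul hIs), fun x => ?_⟩
  rw [H.deriv_particular]
  have h1 := ((hasDerivAt_of_smooth (contDiff_deriv H.solves_energy.1) x).mul
      (((hasDerivAt_of_smooth H.smooth_wave x).pow 2).div_const 2)).sub
    ((hasDerivAt_of_smooth (contDiff_deriv (contDiff_deriv H.smooth_wave)) x).mul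
      (hI x))
  refine h1.deriv.trans ?_
  have h2 := H.wronskian_energy x
  rw [H.solves_energy.2, H.solves_deriv.2]
  simp only [wronskian] at h2
  simp [particular]
  linear_combination (U x) * h2

/-- Translation by T preserves both the equation and the Wronskian, so the increment over a period
is a multiple of U'. -/
theorem exists_shift_particular (H : WaveVariation T q U y φ tE ta) :
    ∃ τ, ∀ x, particular U y (x + T) = particular U y x - τ * deriv U x := by
  have hs := H.solves_particular
  have hd : deriv (fun x => particular U y (x + T)) = fun x => deriv (particular U y) (x + T) :=
    funext fun x => deriv_comp_add_const _ _ _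
  have hd2 : deriv (fun x => deriv (particular U y) (x + T)) =
      fun x => deriv (deriv (particular U y)) (x + T) :=
    funext fun x => deriv_comp_add_const _ _ _
  have hshift : HillSolves q U (fun x => particular U y (x + T)) := by
    refine ⟨hs.1.comp (by fun_prop), fun x => ?_⟩
    rw [hd, hd2]
    simp only [hs.2, H.periodic_q x, H.periodic_wave x]
  have hw : ∀ x, wronskian U (fun x => particular U y (x + T)) x = U x ^ 2 / 2 := fun x => by
    have h1 := H.wronskian_particular (x + T)
    have p1 := periodic_deriv H.periodic_wave
    have p2 := periodic_deriv p1
    simp only [wronskian, hd] at h1 ⊢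
    rwa [p1 x, p2 x, H.periodic_wave x] at h1
  have hh := hshift.comb hs 1 (-1)
  obtain ⟨α, hα⟩ := H.eq_mul_deriv (h := fun x => 1 * particular U y (x + T) +
      -1 * particular U y x) ⟨hh.1, fun x => by rw [hh.2]; ring⟩ fun x => by
    rw [wronskian_comb hshift.1 hs.1, hw, H.wronskian_particular]
    ring
  exact ⟨-α, fun x => by linarith [hα x]⟩

/-- Every variation is a combination of those by the constant of integration and the particular
solution, up to a multiple of `U'`. -/
theorem variation_eq (H : WaveVariation T q U y φ tE ta) {τ : ℝ}
    (hτ : ∀ x, particular U y (x + T) = particular U y x - τ * deriv U x) {χ : ℝ → ℝ} {A C t : ℝ}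
    (hχ : HillSolves q (fun x => A + C * U x) χ)
    (hw : ∀ x, wronskian U χ x = A * U x + C / 2 * U x ^ 2)
    (hshift : ∀ x, χ (x + T) = χ x - t * deriv U x) :
    t = A * ta + C * τ ∧
      massVar T U χ t = A * massVar T U φ ta + C * massVar T U (particular U y) τ ∧
      squareVar T U χ t = A * squareVar T U φ ta + C * squareVar T U (particular U y) τ := by
  have hcomb := H.solves_force.comb H.solves_particular A C
  have hdiff := hχ.comb hcomb 1 (-1)
  obtain ⟨α, hα⟩ := H.eq_mul_deriv (h := fun x => 1 * χ x +
      -1 * (A * φ x + C * particular U y x)) ⟨hdiff.1, fun x => by rw [hdiff.2]; ring⟩ fun x => by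
    rw [wronskian_comb hχ.1 hcomb.1, hw, wronskian_comb H.solves_force.1 H.solves_particular.1,
      H.wronskian_force, H.wronskian_particular]
    ring
  have hχeq : χ = fun x => 1 * (A * φ x + C * particular U y x) + α * deriv U x :=
    funext fun x => by linarith [hα x]
  have ht : t = A * ta + C * τ := by
    obtain ⟨x, hx⟩ := H.exists_deriv_ne_zero
    have h1 := hshift x
    simp only [hχeq, H.shift_force, hτ, periodic_deriv H.periodic_wave x] at h1
    have : (t - (A * ta + C * τ)) * deriv U x = 0 := by linarith
    linarith [(mul_eq_zero.1 this).resolve_right hx]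
  have hU' := contDiff_deriv H.smooth_wave
  have hv := H.solves_particular.1
  -- The summand U' is periodic, so it carries period variation 0; its mass and square variations
  -- vanish too.
  have e : t = 1 * (A * ta + C * τ) + α * 0 := by linarith
  have m0 : massVar T U (deriv U) 0 = 0 := by simp [massVar, H.integral_deriv]
  have n0 : squareVar T U (deriv U) 0 = 0 := by
    simp only [squareVar, H.integral_mul_deriv]; simp
  refine ⟨ht, ?_, ?_⟩
  · rw [hχeq, e, massVar_comb hcomb.1 hU', massVar_comb H.solves_force.1 hv, m0]
    ring
  · rw [hχeq, e, squareVar_comb H.smooth_wave hcomb.1 hU',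
      squareVar_comb H.smooth_wave H.solves_force.1 hv, n0]
    ring

/-- The periodic mean-zero solution of `h'' = q h + U + const`. -/
theorem exists_periodic_solution (H : WaveVariation T q U y φ tE ta) {τ : ℝ}
    (hτ : ∀ x, particular U y (x + T) = particular U y x - τ * deriv U x) {α β : ℝ}
    (ht : τ + α * ta + β * tE = 0)
    (hm : massVar T U (particular U y) τ + α * massVar T U φ ta + β * massVar T U y tE = 0) :
    ∃ v : ℝ → ℝ, HillSolves q (fun x => U x + α) v ∧ Function.Periodic v T ∧
      ∫ x in (0 : ℝ)..T, v x = 0 ∧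
      ∫ x in (0 : ℝ)..T, 2 * (U x * v x) =
        squareVar T U (particular U y) τ + α * squareVar T U φ ta + β * squareVar T U y tE := by
  have hp := H.solves_particular
  have hc := H.solves_force.comb H.solves_energy α β
  have hv := hp.comb hc 1 1
  have e : 1 * τ + 1 * (α * ta + β * tE) = 0 := by linarith
  refine ⟨_, ⟨hv.1, fun x => by rw [hv.2]; ring⟩, fun x => ?_, ?_, ?_⟩
  · simp only [H.shift_force, H.shift_energy, hτ]
    linear_combination (-deriv U x) * ht
  · have := massVar_comb (T := T) (U := U) hp.1 hc.1 1 1 τ (α * ta + β * tE)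
    rw [massVar_comb H.solves_force.1 H.solves_energy.1, e] at this
    simp only [massVar] at this hm
    linarith
  · have := squareVar_comb (T := T) H.smooth_wave hp.1 hc.1 1 1 τ (α * ta + β * tE)
    rw [squareVar_comb H.smooth_wave H.solves_force.1 H.solves_energy.1, e] at this
    rw [squareVar] at this
    linarith

end WaveVariation

/-! ### Periodic functions as elements of `L²_per` -/

section L2

variable {T : ℝ}

theorem memLp_of_continuous {g : ℝ → ℝ} (hg : Continuous g) (T : ℝ) :
    MemLp g 2 (volume.restrict (Ioc (0 : ℝ) T)) := by
  obtain ⟨C, hC⟩ := (isCompact_Icc (a := (0 : ℝ)) (b := T)).exists_bound_of_continuousOn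
    hg.continuousOn
  refine MemLp.of_bound hg.aestronglyMeasurable C ?_
  filter_upwards [ae_restrict_mem measurableSet_Ioc] with x hx
  exact hC x ⟨hx.1.le, hx.2⟩

theorem toL2per_ae {g : ℝ → ℝ} (hg : Continuous g) :
    toL2per T g =ᵐ[volume.restrict (Ioc (0 : ℝ) T)] g := by
  rw [toL2per, dif_pos (memLp_of_continuous hg T)]
  exact MemLp.coeFn_toLp _

theorem toL2per_comb {g h : ℝ → ℝ} (hg : Continuous g) (hh : Continuous h) (a b : ℝ) :
    toL2per T (fun x => a * g x + b * h x) = a • toL2per T g + b • toL2per T h := by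
  refine Lp.ext ?_
  filter_upwards [toL2per_ae (T := T) hg, toL2per_ae (T := T) hh,
    toL2per_ae (T := T) (g := fun x => a * g x + b * h x) (by fun_prop),
    Lp.coeFn_add (a • toL2per T g) (b • toL2per T h), Lp.coeFn_smul a (toL2per T g),
    Lp.coeFn_smul b (toL2per T h)] with x h1 h2 h3 h4 h5 h6
  rw [h3, h4, Pi.add_apply, h5, h6]
  simp [h1, h2]

theorem toL2per_zero : toL2per T (fun _ => 0) = 0 := by
  simpa using toL2per_comb (T := T) (g := fun _ => 0) (h := fun _ => 0) continuous_const
    continuous_const 0 0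

theorem integral_mul_eq_inner (hT : 0 < T) {φ : ℝ → ℝ} (hφ : Continuous φ) (u : L2per T) :
    ∫ x in (0 : ℝ)..T, u x * φ x = inner ℝ (toL2per T φ) u := by
  rw [intervalIntegral.integral_of_le hT.le, L2.inner_def]
  refine integral_congr_ae ?_
  filter_upwards [toL2per_ae (T := T) hφ] with x hx
  simp [hx]

theorem integral_eq_inner (hT : 0 < T) (u : L2per T) :
    ∫ x in (0 : ℝ)..T, u x = inner ℝ (toL2per T fun _ => 1) u := by
  rw [← integral_mul_eq_inner hT continuous_const]
  simp

theorem inner_toL2per (hT : 0 < T) {g h : ℝ → ℝ} (hg : Continuous g) (hh : Continuous h) :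
    inner ℝ (toL2per T g) (toL2per T h) = ∫ x in (0 : ℝ)..T, g x * h x := by
  rw [intervalIntegral.integral_of_le hT.le, L2.inner_def]
  refine integral_congr_ae ?_
  filter_upwards [toL2per_ae (T := T) hg, toL2per_ae (T := T) hh] with x h1 h2
  simp [h1, h2, mul_comm]

theorem integral_toL2per (hT : 0 < T) {g : ℝ → ℝ} (hg : Continuous g) :
    ∫ x in (0 : ℝ)..T, toL2per T g x = ∫ x in (0 : ℝ)..T, g x := by
  rw [integral_eq_inner hT, inner_toL2per hT continuous_const hg]
  simp

theorem isDeriv_iff (hT : 0 < T) {u v : L2per T} :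
    IsDeriv u v ↔ ∀ φ : ℝ → ℝ, ContDiff ℝ ∞ φ → Function.Periodic φ T →
      inner ℝ (toL2per T (deriv φ)) u = - inner ℝ (toL2per T φ) v := by
  refine forall_congr' fun φ => forall_congr' fun hφ => forall_congr' fun _ => ?_
  rw [integral_mul_eq_inner hT (contDiff_deriv hφ).continuous,
    integral_mul_eq_inner hT hφ.continuous]

theorem IsDeriv.comb (hT : 0 < T) {u v u' v' : L2per T} (h : IsDeriv u v) (h' : IsDeriv u' v')
    (a b : ℝ) : IsDeriv (a • u + b • u') (a • v + b • v') := by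
  rw [isDeriv_iff hT] at *
  intro φ hφ hp
  simp only [inner_add_right, inner_smul_right, h φ hφ hp, h' φ hφ hp]
  ring

theorem IsDeriv.smul (hT : 0 < T) {u v : L2per T} (h : IsDeriv u v) (a : ℝ) :
    IsDeriv (a • u) (a • v) := by
  simpa only [zero_smul, add_zero] using h.comb hT h a 0

theorem proj₀_comb (hT : 0 < T) (u u' : L2per T) (a b : ℝ) :
    proj₀ (a • u + b • u') = a • proj₀ u + b • proj₀ u' := by
  simp only [proj₀, integral_eq_inner hT, inner_add_right, inner_smul_right]
  module

theorem IsHill.comb (hT : 0 < T) {q : ℝ → ℝ} {u z u' z' : L2per T} (h : IsHill q u z)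
    (h' : IsHill q u' z') (a b : ℝ) : IsHill q (a • u + b • u') (a • z + b • z') := by
  obtain ⟨v, w, hv, hw, hz⟩ := h
  obtain ⟨v', w', hv', hw', hz'⟩ := h'
  refine ⟨_, _, hv.comb hT hv' a b, hw.comb hT hw' a b, ?_⟩
  filter_upwards [hz, hz', Lp.coeFn_add (a • u) (b • u'), Lp.coeFn_smul a u, Lp.coeFn_smul b u',
    Lp.coeFn_add (a • w) (b • w'), Lp.coeFn_smul a w, Lp.coeFn_smul b w',
    Lp.coeFn_add (a • z) (b • z'), Lp.coeFn_smul a z, Lp.coeFn_smul b z']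
    with x h1 h2 h3 h4 h5 h6 h7 h8 h9 h10 h11
  simp only [h3, h4, h5, h6, h7, h8, h9, h10, h11, Pi.add_apply, Pi.smul_apply, smul_eq_mul, h1, h2]
  ring

theorem IsA.comb (hT : 0 < T) {q : ℝ → ℝ} {u w u' w' : L2per T} (h : IsA q u w)
    (h' : IsA q u' w') (a b : ℝ) : IsA q (a • u + b • u') (a • w + b • w') := by
  obtain ⟨h0, v, z, y, hv, hz, hy, rfl⟩ := h
  obtain ⟨h0', v', z', y', hv', hz', hy', rfl⟩ := h'
  refine ⟨?_, a • v + b • v', a • z + b • z', a • y + b • y', hv.comb hT hv' a b, ?_, ?_, ?_⟩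
  · rw [integral_eq_inner hT] at *
    simp [inner_add_right, inner_smul_right, h0, h0']
  · rw [proj₀_comb hT]; exact hz.comb hT hz' a b
  · rw [proj₀_comb hT]; exact hy.comb hT hy' a b
  · module

theorem IsA.smul (hT : 0 < T) {q : ℝ → ℝ} {u w : L2per T} (h : IsA q u w) (a : ℝ) :
    IsA q (a • u) (a • w) := by
  simpa only [zero_smul, add_zero] using h.comb hT h a 0

/-- A weak derivative of 0 pairs to zero with every test function, so it can be replaced by 0 in the
graph. This makes uniqueness of weak derivatives unnecessary later. -/
theorem IsA.zero_of_isDeriv_zero (hT : 0 < T) {q : ℝ → ℝ} {u w : L2per T} (h : IsA q u w)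
    (hw : IsDeriv 0 w) : IsA q u 0 := by
  obtain ⟨h0, v, z, y, hv, hz, hy, rfl⟩ := h
  refine ⟨h0, v, z, 0, hv, hz, ?_, by simp⟩
  rw [isDeriv_iff hT] at *
  intro φ hφ hp
  have h1 := hw φ hφ hp
  rw [hy φ hφ hp]
  simp only [inner_zero_right, inner_neg_right, neg_neg] at h1 ⊢
  simp [← h1]

theorem isDeriv_toL2per (hT : 0 < T) {g : ℝ → ℝ} (hg : ContDiff ℝ ∞ g)
    (hp : Function.Periodic g T) : IsDeriv (toL2per T g) (toL2per T (deriv g)) := by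
  rw [isDeriv_iff hT]
  intro φ hφ hpφ
  have hg' := contDiff_deriv hg
  have hφ' := contDiff_deriv hφ
  rw [inner_toL2per hT hφ'.continuous hg.continuous, inner_toL2per hT hφ.continuous hg'.continuous]
  have key := intervalIntegral.integral_mul_deriv_eq_deriv_mul (a := 0) (b := T) (u := φ) (v := g)
    (fun x _ => hasDerivAt_of_smooth hφ x) (fun x _ => hasDerivAt_of_smooth hg x)
    (hφ'.continuous.intervalIntegrable _ _) (hg'.continuous.intervalIntegrable _ _)
  have e1 := hp 0
  have e2 := hpφ 0
  rw [zero_add] at e1 e2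
  rw [key, e1, e2]
  ring

theorem proj₀_toL2per (hT : 0 < T) {g : ℝ → ℝ} (hg : Continuous g) :
    proj₀ (toL2per T g) = toL2per T fun x => g x - 1 / T * ∫ x in (0 : ℝ)..T, g x := by
  have := toL2per_comb (T := T) hg (continuous_const (y := (1 : ℝ))) 1
    (-(1 / T * ∫ x in (0 : ℝ)..T, g x))
  rw [proj₀, integral_toL2per hT hg, sub_eq_add_neg, ← neg_smul]
  rw [one_smul] at this
  rw [← this]
  congr 1
  funext x
  ring

/-- The Hill operator sends W' to -z, and the projection changes this only by a constant, which the
outer derivative kills. W' is already mean-zero by periodicity. -/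
theorem isA_toL2per (hT : 0 < T) {q W z : ℝ → ℝ} (hW : ContDiff ℝ ∞ W)
    (hp : Function.Periodic W T) (h0 : ∫ x in (0 : ℝ)..T, W x = 0) (hz : ContDiff ℝ ∞ z)
    (hpz : Function.Periodic z T) (hhill : HillSolves q z (deriv W)) :
    IsA q (toL2per T W) (toL2per T (deriv z)) := by
  have hW1 := contDiff_deriv hW
  have hW2 := contDiff_deriv hW1
  have hW3 := contDiff_deriv hW2
  have hp1 := periodic_deriv hp
  have hp2 := periodic_deriv hp1
  have hz1 := contDiff_deriv hz
  have hproj : proj₀ (toL2per T (deriv W)) = toL2per T (deriv W) := by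
    rw [proj₀_toL2per hT hW1.continuous, intervalIntegral.integral_deriv_eq_sub
      (fun x _ => (hasDerivAt_of_smooth hW x).differentiableAt)
      (hW1.continuous.intervalIntegrable _ _)]
    have e := hp 0
    rw [zero_add] at e
    simp [e]
  have hneg : ∀ {g : ℝ → ℝ}, Continuous g → toL2per T (fun x => -g x) = -toL2per T g :=
    fun {g} hg => by
      have := toL2per_comb (T := T) hg hg (-1) 0
      simpa using this
  refine ⟨by rw [integral_toL2per hT hW.continuous, h0], toL2per T (deriv W),
    toL2per T (fun x => -z x), toL2per T (fun x => -deriv z x),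
    isDeriv_toL2per hT hW hp, ?_, ?_, ?_⟩
  · rw [hproj]
    refine ⟨_, _, isDeriv_toL2per hT hW1 hp1, isDeriv_toL2per hT hW2 hp2, ?_⟩
    filter_upwards [toL2per_ae (T := T) (g := fun x => -z x) hz.continuous.neg,
      toL2per_ae (T := T) hW3.continuous, toL2per_ae (T := T) hW1.continuous] with x h1 h2 h3
    rw [h1, h2, h3, hhill.2]
    ring
  · rw [proj₀_toL2per hT (g := fun x => -z x) hz.continuous.neg]
    have hd : deriv (fun x => -z x - 1 / T * ∫ x in (0 : ℝ)..T, -z x) = fun x => -deriv z x :=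
      funext fun x => by simp
    rw [← hd]
    exact isDeriv_toL2per hT (hz.neg.sub contDiff_const) fun x => by simp [hpz x]
  · rw [hneg hz1.continuous, neg_neg]

theorem exists_periodic_antideriv (hT : 0 < T) {h : ℝ → ℝ} (hh : ContDiff ℝ ∞ h)
    (hp : Function.Periodic h T) (h0 : ∫ x in (0 : ℝ)..T, h x = 0) :
    ∃ W : ℝ → ℝ, ContDiff ℝ ∞ W ∧ Function.Periodic W T ∧ ∫ x in (0 : ℝ)..T, W x = 0 ∧
      deriv W = h := by
  let I : ℝ → ℝ := fun x => ∫ r in (0 : ℝ)..x, h r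
  have hI : ∀ x, HasDerivAt I (h x) x := fun x =>
    intervalIntegral.integral_hasDerivAt_right (hh.continuous.intervalIntegrable _ _)
      (hh.continuous.stronglyMeasurableAtFilter _ _) hh.continuous.continuousAt
  have hId : deriv I = h := funext fun x => (hI x).deriv
  have hIs : ContDiff ℝ ∞ I := by
    rw [contDiff_infty_iff_deriv, hId]
    exact ⟨fun x => (hI x).differentiableAt, hh⟩
  have hIp : Function.Periodic I T := fun x => by
    have h1 := intervalIntegral.integral_add_adjacent_intervals (μ := volume) (a := 0) (b := x)
      (c := x + T) (hh.continuous.intervalIntegrable _ _) (hh.continuous.intervalIntegrable _ _)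
    have h2 := hp.intervalIntegral_add_eq x 0
    rw [zero_add, h0] at h2
    rw [h2, add_zero] at h1
    exact h1.symm
  refine ⟨fun x => I x - (∫ r in (0 : ℝ)..T, I r) / T, hIs.sub contDiff_const,
    fun x => by simp [hIp x], ?_, ?_⟩
  · rw [intervalIntegral.integral_sub (hIs.continuous.intervalIntegrable _ _)
      intervalIntegrable_const]
    simp
    field_simp
    ring
  · rw [← hId]
    funext x
    simp

theorem eq_of_toL2per_eq (hT : 0 < T) {g h : ℝ → ℝ} (hg : Continuous g) (hh : Continuous h)
    (hpg : Function.Periodic g T) (hph : Function.Periodic h T)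
    (he : toL2per T g = toL2per T h) : g = h := by
  have hae : g =ᵐ[volume.restrict (Ioc (0 : ℝ) T)] h :=
    (toL2per_ae hg).symm.trans ((by rw [he] : toL2per T g =ᵐ[_] toL2per T h).trans
      (toL2per_ae hh))
  have heq := Measure.eqOn_Ioc_of_ae_eq volume hae hg.continuousOn hh.continuousOn
  funext x
  obtain ⟨y, hy, hxy⟩ := (hpg.sub hph).exists_mem_Ioc hT x 0
  rw [zero_add] at hy
  have h1 : g y - h y = 0 := sub_eq_zero.2 (heq hy)
  simp only [Pi.sub_apply, h1] at hxy
  linarith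

end L2

/-! ### The kernel of `𝒜` and the restricted scalar -/

section Scalar

variable {T : ℝ} {q U : ℝ → ℝ} {m : ℝ}

/-- A constant forcing k has zero derivative, so the periodic mean-zero antiderivative of h lies in
ker 𝒜, hence is a multiple of U - m. -/
theorem kernelIsLine_of_kerA_subset (hT : 0 < T) (hU : ContDiff ℝ ∞ U)
    (hpU : Function.Periodic U T)
    (hker : kerA q ⊆ (Submodule.span ℝ {toL2per T fun x => U x - m} : Set (L2per T))) :
    KernelIsLine T q U := by
  intro h k hh hp h0
  obtain ⟨W, hW, hpW, hW0, rfl⟩ := exists_periodic_antideriv hT hh.1 hp h0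
  have hmem := isA_toL2per hT hW hpW hW0 contDiff_const (fun _ => rfl) hh
  rw [show deriv (fun _ : ℝ => k) = fun _ => 0 from funext fun x => deriv_const x k,
    toL2per_zero] at hmem
  obtain ⟨κ, hκ⟩ := Submodule.mem_span_singleton.1 (hker hmem)
  have hc := hU.continuous
  have h1 := toL2per_comb (T := T) (g := fun x => U x - m) (h := fun x => U x - m)
    (by fun_prop) (by fun_prop) κ 0
  rw [zero_smul, add_zero, hκ] at h1
  have h2 := eq_of_toL2per_eq hT (by fun_prop) hW.continuous
    (fun x => by simp [hpU x]) hpW h1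
  refine ⟨κ, fun x => ?_⟩
  rw [← h2]
  simp

/-- With W' = v one has 𝒜W = U' = ∂ₓ(U - m). Removing the kernel component of W gives 𝒜⁻¹U' and
changes v only by a multiple of U', which is orthogonal to U - m. The entry is quadratic in the
scaling c of the basis vector. -/
theorem isRestrictedEntry_iff (hT : 0 < T) (hU : ContDiff ℝ ∞ U)
    (hpU : Function.Periodic U T) (hne : ∃ x z, U x ≠ U z)
    (hker : kerA q = (Submodule.span ℝ {toL2per T fun x => U x - m} : Set (L2per T)))
    {v : ℝ → ℝ} {α : ℝ} (hv : HillSolves q (fun x => U x + α) v) (hpv : Function.Periodic v T)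
    (hv0 : ∫ x in (0 : ℝ)..T, v x = 0) (κ c r : ℝ) :
    IsRestrictedEntry q κ (c • toL2per T fun x => U x - m) r ↔
      r = c ^ 2 * ((∫ x in (0 : ℝ)..T, (U x - m) * (U x - m)) -
        κ * ∫ x in (0 : ℝ)..T, U x * v x) := by
  have hUc := hU.continuous
  have hU' := contDiff_deriv hU
  set e : L2per T := toL2per T fun x => U x - m with he
  have hes : ContDiff ℝ ∞ fun x => U x - m := hU.sub contDiff_const
  have hep : Function.Periodic (fun x => U x - m) T := fun x => by simp [hpU x]
  have hed : deriv (fun x => U x - m) = deriv U := funext fun x => by simp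
  have hede : IsDeriv e (toL2per T (deriv U)) := by
    rw [← hed]; exact isDeriv_toL2per hT hes hep
  have heA : IsA q e 0 := by
    have : e ∈ kerA q := by rw [hker]; exact Submodule.mem_span_singleton_self e
    exact this
  have hee : inner ℝ e e ≠ 0 := by
    rw [inner_self_ne_zero]
    intro h0
    rw [he, ← toL2per_zero] at h0
    have h1 := eq_of_toL2per_eq hT hes.continuous continuous_const hep (fun _ => rfl) h0
    obtain ⟨x, z, hxz⟩ := hne
    have hx : U x - m = 0 := congrFun h1 x
    have hz : U z - m = 0 := congrFun h1 z
    exact hxz (by linarith)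
  obtain ⟨W, hW, hpW, hW0, hWd⟩ := exists_periodic_antideriv hT hv.1 hpv hv0
  have hWA : IsA q (toL2per T W) (toL2per T (deriv U)) := by
    have hd : deriv (fun x => U x + α) = deriv U := funext fun x => by simp
    rw [← hd]
    exact isA_toL2per hT hW hpW hW0 (hU.add contDiff_const) (fun x => by simp [hpU x])
      (by rwa [hWd])
  -- Coefficient that makes W + γe orthogonal to the kernel.
  let γ : ℝ := -(inner ℝ (toL2per T W) e / inner ℝ e e)
  let W₀ : L2per T := (1 : ℝ) • toL2per T W + γ • e
  have hW₀A : IsA q W₀ (toL2per T (deriv U)) := by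
    simpa only [one_smul, smul_zero, add_zero, W₀] using hWA.comb hT heA 1 γ
  have hW₀perp : ∀ k ∈ kerA q, inner ℝ W₀ k = 0 := fun k hk => by
    rw [hker] at hk
    obtain ⟨a, rfl⟩ := Submodule.mem_span_singleton.1 hk
    simp only [W₀, γ, one_smul, inner_smul_right, inner_add_left, inner_smul_left,
      RCLike.conj_to_real]
    field_simp
    ring
  have hvd : IsDeriv (toL2per T W) (toL2per T v) := by
    rw [← hWd]; exact isDeriv_toL2per hT hW hpW
  have hW₀d := hvd.comb hT hede 1 γ
  -- Since e has a smooth periodic representative, it can serve as the test function; the pairing is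
  -- then the same for every weak derivative w' of w.
  have hpair : ∀ {w w' : L2per T}, IsDeriv w w' →
      inner ℝ e w' = -inner ℝ (toL2per T (deriv U)) w := fun {w w'} hw => by
    have := (isDeriv_iff hT).1 hw _ hes hep
    rw [hed] at this
    rw [this, neg_neg]
  have heU : inner ℝ e (toL2per T (deriv U)) = 0 := by
    linarith [hpair hede, real_inner_comm e (toL2per T (deriv U))]
  have hev : inner ℝ e (toL2per T v) = ∫ x in (0 : ℝ)..T, U x * v x := by
    have hvc := hv.1.continuous
    rw [he, inner_toL2per hT hes.continuous hvc]
    simp_rw [sub_mul]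
    rw [intervalIntegral.integral_sub (Continuous.intervalIntegrable (by fun_prop) _ _)
      (Continuous.intervalIntegrable (by fun_prop) _ _), intervalIntegral.integral_const_mul, hv0]
    simp
  have hW₀U : inner ℝ (toL2per T (deriv U)) W₀ = -∫ x in (0 : ℝ)..T, U x * v x := by
    have h1 := hpair hW₀d
    rw [inner_add_right, inner_smul_right, inner_smul_right, heU, hev] at h1
    linarith
  have heeI : inner ℝ e e = ∫ x in (0 : ℝ)..T, (U x - m) * (U x - m) :=
    inner_toL2per hT hes.continuous hes.continuous
  have hval : ∀ {w'}, IsDeriv (c • W₀) w' → inner ℝ (c • e) (c • e - κ • w') =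
      c ^ 2 * ((∫ x in (0 : ℝ)..T, (U x - m) * (U x - m)) -
        κ * ∫ x in (0 : ℝ)..T, U x * v x) := fun {w'} hw' => by
    have h1 := hpair hw'
    rw [inner_smul_right, hW₀U] at h1
    simp only [inner_sub_right, inner_smul_right, inner_smul_left, RCLike.conj_to_real, h1, heeI]
    ring
  have hce : IsDeriv (c • e) (c • toL2per T (deriv U)) := hede.smul hT c
  constructor
  · rintro ⟨e', w, w', he', ⟨hwA, hwperp⟩, hw', rfl⟩
    -- Uniqueness: w - cW₀ lies in ker 𝒜, as e' and cU' are weak derivatives of the same function,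
    -- and it is orthogonal to ker 𝒜, so it vanishes.
    have hD := hwA.comb hT hW₀A 1 (-c)
    have hD0 : IsDeriv (0 : L2per T) ((1 : ℝ) • e' + (-c) • toL2per T (deriv U)) := by
      have := he'.comb hT hede 1 (-c)
      rwa [show (1 : ℝ) • c • e + (-c) • e = 0 by module] at this
    have hDker : (1 : ℝ) • w + (-c) • W₀ ∈ kerA q := hD.zero_of_isDeriv_zero hT hD0
    have hDzero : (1 : ℝ) • w + (-c) • W₀ = 0 := by
      rw [← inner_self_eq_zero (𝕜 := ℝ), inner_add_left, inner_smul_left, inner_smul_left,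
        hwperp _ hDker, hW₀perp _ hDker]
      simp
    have hwW : w = c • W₀ := by
      rw [one_smul, neg_smul, ← sub_eq_add_neg] at hDzero
      exact sub_eq_zero.1 hDzero
    rw [hwW] at hw'
    exact hval hw'
  · rintro rfl
    have hd : IsDeriv (c • W₀) (c • ((1 : ℝ) • toL2per T v + γ • toL2per T (deriv U))) := hW₀d.smul hT c
    refine ⟨_, c • W₀, _, hce, ⟨?_, fun k hk => ?_⟩, hd, (hval hd).symm⟩
    · exact hW₀A.smul hT c
    · rw [inner_smul_left, hW₀perp k hk, mul_zero]

end Scalar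

/-! ### Local diffeomorphisms of the parameter space -/

theorem isLocalDiffeo_of_det_ne_zero {Ω : Set Param} (hΩ : IsOpen Ω) {G : Param → Fin 4 → ℝ}
    (hG : ContDiffOn ℝ ∞ G Ω) {p : Param} (hp : p ∈ Ω) (hdet : (fderiv ℝ G p).det ≠ 0) :
    IsLocalDiffeo Ω G p := by
  have hGat : ∀ x ∈ Ω, ContDiffAt ℝ ∞ G x := fun x hx => hG.contDiffAt (hΩ.mem_nhds hx)
  have hinv : ∀ x ∈ Ω, ∀ h : (fderiv ℝ G x).det ≠ 0,
      HasFDerivAt G ((fderiv ℝ G x).toContinuousLinearEquivOfDetNeZero h : Param →L[ℝ] _) x :=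
    fun x hx h => by
      rw [ContinuousLinearMap.coe_toContinuousLinearEquivOfDetNeZero]
      exact ((hGat x hx).differentiableAt (by simp)).hasFDerivAt
  -- Restricting to the open set where the Jacobian is nonzero makes the inverse smooth on the whole
  -- target, not only at the image of p.
  let S : Set Param := Ω ∩ (fun x => (fderiv ℝ G x).det) ⁻¹' {0}ᶜ
  have hS : IsOpen S := ContinuousOn.isOpen_inter_preimage
    (ContinuousLinearMap.continuous_det.comp_continuousOn
      (hG.continuousOn_fderiv_of_isOpen hΩ (by simp))) hΩ isOpen_compl_singleton
  let Φ₀ := (hGat p hp).toOpenPartialHomeomorph G (hinv p hp hdet) (by simp)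
  have hΦ₀ : p ∈ Φ₀.source :=
    (hGat p hp).mem_toOpenPartialHomeomorph_source (hinv p hp hdet) (by simp)
  have hcoe : (Φ₀ : Param → Fin 4 → ℝ) = G := rfl
  refine ⟨Φ₀.restrOpen S hS, ?_, ?_, ?_, ?_, ?_⟩
  · rw [OpenPartialHomeomorph.restrOpen_source]
    exact ⟨hΦ₀, hp, hdet⟩
  · rw [OpenPartialHomeomorph.restrOpen_source]
    exact fun x hx => hx.2.1
  · exact fun x _ => rfl
  · rw [OpenPartialHomeomorph.restrOpen_source]
    exact hG.mono fun x hx => hx.2.1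
  · intro z hz
    have hz' := (Φ₀.restrOpen S hS).map_target hz
    rw [OpenPartialHomeomorph.restrOpen_source] at hz'
    have hx : (Φ₀.restrOpen S hS).symm z ∈ Ω := hz'.2.1
    exact ((Φ₀.restrOpen S hS).contDiffAt_symm hz (hinv _ hx hz'.2.2)
      (hGat _ hx)).contDiffWithinAt

/-! ### The Jacobian determinant -/

theorem det_fin_four (a₀ a₁ a₂ a₃ b₀ b₁ b₂ b₃ c₀ c₁ c₂ c₃ d₀ d₁ d₂ d₃ : ℝ) :
    Matrix.det !![a₀, a₁, a₂, a₃; b₀, b₁, b₂, b₃; c₀, c₁, c₂, c₃; d₀, d₁, d₂, d₃] =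
      a₀ * (b₁ * (c₂ * d₃ - c₃ * d₂) - b₂ * (c₁ * d₃ - c₃ * d₁) + b₃ * (c₁ * d₂ - c₂ * d₁)) -
      a₁ * (b₀ * (c₂ * d₃ - c₃ * d₂) - b₂ * (c₀ * d₃ - c₃ * d₀) + b₃ * (c₀ * d₂ - c₂ * d₀)) +
      a₂ * (b₀ * (c₁ * d₃ - c₃ * d₁) - b₁ * (c₀ * d₃ - c₃ * d₀) + b₃ * (c₀ * d₁ - c₁ * d₀)) -
      a₃ * (b₀ * (c₁ * d₂ - c₂ * d₁) - b₁ * (c₀ * d₂ - c₂ * d₀) + b₂ * (c₀ * d₁ - c₁ * d₀)) := by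
  simp [Matrix.det_succ_row_zero, Fin.sum_univ_succ, Fin.succAbove]
  ring

/-- `det₄` is the transposed Jacobian with the rows for a and E interchanged, hence the sign. -/
theorem det_fderiv_conserved {u : ℝ → Param → ℝ} {p : Param}
    (hG : DifferentiableAt ℝ (conserved u) p) :
    (fderiv ℝ (conserved u) p).det = -det₄ u p := by
  have hentry : ∀ i j : Fin 4, LinearMap.toMatrix' (fderiv ℝ (conserved u) p).toLinearMap i j =
      pd j (fun p => conserved u p i) p := fun i j => by
    rw [LinearMap.toMatrix'_apply]
    have h := (hasFDerivAt_pi'.1 hG.hasFDerivAt i).fderiv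
    simp only [pd]
    rw [h]
    simp
  have hmat : LinearMap.toMatrix' (fderiv ℝ (conserved u) p).toLinearMap =
      !![pd 0 (period u) p, pd 1 (period u) p, pd 2 (period u) p, pd 3 (period u) p;
        pd 0 (casimir₁ u) p, pd 1 (casimir₁ u) p, pd 2 (casimir₁ u) p, pd 3 (casimir₁ u) p;
        pd 0 (momentum u) p, pd 1 (momentum u) p, pd 2 (momentum u) p, pd 3 (momentum u) p;
        pd 0 (casimir₂ u) p, pd 1 (casimir₂ u) p, pd 2 (casimir₂ u) p, pd 3 (casimir₂ u) p] := by
    ext i j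
    rw [hentry]
    fin_cases i <;> fin_cases j <;> rfl
  rw [ContinuousLinearMap.det, ← LinearMap.det_toMatrix', hmat, det₄, det_fin_four, det_fin_four]
  ring

/-! ### The linearised family at a given wave -/

namespace IsPeriodicWaveFamily

variable {f F : ℝ → ℝ} {Ω : Set Param} {u : ℝ → Param → ℝ}

theorem hillSolves_dp (hu : IsPeriodicWaveFamily f F Ω u) (hf : ContDiff ℝ ∞ f) (hΩ : IsOpen Ω)
    {p : Param} (hp : p ∈ Ω) (i : Fin 4) {A C : ℝ}
    (hA : pd i (fun p => p 0 + p 2 * p 3) p = A) (hC : pd i (fun p => 1 - p 2 ^ 2) p = C) :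
    HillSolves (hillPotential f u p) (fun x => A + C * u x p) (fun x => dp i (wave u) (x, p)) := by
  have h1 := contDiffOn_dp hΩ hu.smooth_wave i
  refine ⟨contDiff_slice h1 hp, fun x => ?_⟩
  rw [deriv_slice hΩ h1 hp, deriv_slice hΩ (contDiffOn_dx hΩ h1) hp]
  simp only
  rw [hu.dp_ode hf hΩ hp i hA hC]
  ring

theorem wronskian_dp (hu : IsPeriodicWaveFamily f F Ω u) (hF : ∀ y : ℝ, HasDerivAt F (f y) y)
    (hΩ : IsOpen Ω) {p : Param} (hp : p ∈ Ω) (i : Fin 4) {A C E : ℝ}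
    (hA : pd i (fun p => p 0 + p 2 * p 3) p = A) (hC : pd i (fun p => 1 - p 2 ^ 2) p = C)
    (hE : pd i (fun p => p 1) p = E) (x : ℝ) :
    wronskian (fun x => u x p) (fun x => dp i (wave u) (x, p)) x =
      E + A * u x p + C / 2 * u x p ^ 2 := by
  have hw : (deriv fun x => u x p) = fun x => dx (wave u) (x, p) :=
    deriv_slice hΩ hu.smooth_wave hp
  rw [wronskian, hw, deriv_slice hΩ (contDiffOn_dx hΩ hu.smooth_wave) hp,
    deriv_slice hΩ (contDiffOn_dp hΩ hu.smooth_wave i) hp]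
  exact hu.dp_energy hF hΩ hp i hA hC hE x

theorem dp_shift_slice (hu : IsPeriodicWaveFamily f F Ω u) (hf : ContDiff ℝ ∞ f) (hΩ : IsOpen Ω)
    {p : Param} (hp : p ∈ Ω) (i : Fin 4) (x : ℝ) :
    dp i (wave u) (x + period u p, p) =
      dp i (wave u) (x, p) - pd i (period u) p * deriv (fun x => u x p) x := by
  rw [hu.dp_shift hf hΩ hp,
    show (deriv fun x => u x p) = fun x => dx (wave u) (x, p) from
      deriv_slice hΩ hu.smooth_wave hp]

theorem hillSolves_deriv (hu : IsPeriodicWaveFamily f F Ω u) (hf : ContDiff ℝ ∞ f)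
    {p : Param} (hp : p ∈ Ω) :
    HillSolves (hillPotential f u p) (fun _ => 0) (deriv fun x => u x p) := by
  have hU : ContDiff ℝ ∞ fun x => u x p := contDiff_slice hu.smooth_wave hp
  refine ⟨contDiff_deriv hU, fun x => ?_⟩
  have h2 : deriv (deriv fun x => u x p) =
      fun x => (p 0 + p 2 * p 3) + (1 - p 2 ^ 2) * u x p - f (u x p) := by
    funext x
    linarith [hu.ode p hp x]
  have hd := hasDerivAt_of_smooth hU x
  have h3 := (((hd.const_mul (1 - p 2 ^ 2)).const_add (p 0 + p 2 * p 3)).sub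
    ((hasDerivAt_of_smooth hf (u x p)).comp x hd))
  rw [h2]
  refine h3.deriv.trans ?_
  simp only [hillPotential]
  ring

theorem waveVariation (hu : IsPeriodicWaveFamily f F Ω u) (hf : ContDiff ℝ ∞ f)
    (hF : ∀ y : ℝ, HasDerivAt F (f y) y) (hΩ : IsOpen Ω) {p : Param} (hp : p ∈ Ω) :
    WaveVariation (period u p) (hillPotential f u p) (fun x => u x p)
      (fun x => dp 1 (wave u) (x, p)) (fun x => dp 0 (wave u) (x, p))
      (pd 1 (period u) p) (pd 0 (period u) p) where
  period_pos := hu.period_pos hp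
  periodic_q x := by
    have := hu.periodic_period hp x
    simp only [wave] at this
    simp [hillPotential, this]
  smooth_wave := contDiff_slice hu.smooth_wave hp
  periodic_wave := hu.periodic_period hp
  nonconstant := hu.nonconstant p hp
  solves_deriv := hu.hillSolves_deriv hf hp
  solves_energy := by
    simpa using hu.hillSolves_dp hf hΩ hp 1 (pd_force 1 p) (pd_speed 1 p)
  wronskian_energy x := by
    simpa using hu.wronskian_dp hF hΩ hp 1 (pd_force 1 p) (pd_speed 1 p) (pd_coord 1 1 p) x
  shift_energy := hu.dp_shift_slice hf hΩ hp 1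
  solves_force := by
    simpa using hu.hillSolves_dp hf hΩ hp 0 (pd_force 0 p) (pd_speed 0 p)
  wronskian_force x := by
    simpa using hu.wronskian_dp hF hΩ hp 0 (pd_force 0 p) (pd_speed 0 p) (pd_coord 0 1 p) x
  shift_force := hu.dp_shift_slice hf hΩ hp 0

theorem integral_meanFree_sq (hu : IsPeriodicWaveFamily f F Ω u) {p : Param} (hp : p ∈ Ω) :
    ∫ x in (0 : ℝ)..period u p,
        (u x p - casimir₁ u p / period u p) * (u x p - casimir₁ u p / period u p) =
      secondMoment u p - casimir₁ u p ^ 2 / period u p := by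
  have hc : Continuous fun x => u x p := (contDiff_slice hu.smooth_wave hp).continuous
  have hT := (hu.period_pos hp).ne'
  set m := casimir₁ u p / period u p with hm
  have hM : casimir₁ u p = m * period u p := by rw [hm]; field_simp
  rw [show (fun x => (u x p - m) * (u x p - m)) =
    fun x => (u x p ^ 2 - 2 * m * u x p) + m ^ 2 by funext x; ring]
  rw [intervalIntegral.integral_add (Continuous.intervalIntegrable (by fun_prop) _ _)
    intervalIntegrable_const,
    intervalIntegral.integral_sub (Continuous.intervalIntegrable (by fun_prop) _ _)
    (Continuous.intervalIntegrable (by fun_prop) _ _), intervalIntegral.integral_const_mul]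
  have h1 : ∫ x in (0 : ℝ)..period u p, u x p = casimir₁ u p := rfl
  have h2 : ∫ x in (0 : ℝ)..period u p, u x p ^ 2 = secondMoment u p := rfl
  rw [h1, h2, hM, intervalIntegral.integral_const]
  simp only [smul_eq_mul, sub_zero]
  field_simp
  ring

end IsPeriodicWaveFamily

end GoodBoussinesq

/-! ### The determinant identity and the local diffeomorphism -/

theorem lemma4p2 (f F : ℝ → ℝ) (hf : ContDiff ℝ ∞ f) (hF : ∀ y : ℝ, HasDerivAt F (f y) y)
    (Ω : Set GoodBoussinesq.Param) (hΩ : IsOpen Ω) (u : ℝ → GoodBoussinesq.Param → ℝ)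
    (hu : GoodBoussinesq.IsPeriodicWaveFamily f F Ω u) :
    ContDiffOn ℝ ∞ (GoodBoussinesq.conserved u) Ω ∧
    ∀ p ∈ Ω,
      GoodBoussinesq.kerA (GoodBoussinesq.hillPotential f u p) =
        (Submodule.span ℝ {GoodBoussinesq.meanFree u p} :
          Set (GoodBoussinesq.L2per (GoodBoussinesq.period u p))) →
      0 < GoodBoussinesq.period u p ∧ GoodBoussinesq.det₂ u p ≠ 0 ∧
      ∃ s : ℝ,
        -- the scalar is well defined, in the basis `U - Ū` of the kernel
        (∀ r : ℝ, GoodBoussinesq.IsScalar f u p (GoodBoussinesq.meanFree u p) r ↔ r = s) ∧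
        -- its relation to the two determinants
        GoodBoussinesq.period u p * GoodBoussinesq.det₂ u p * s = GoodBoussinesq.det₄ u p ∧
        -- the same relation in the basis `T * det₂ • (U - Ū)` of the kernel
        (∀ r : ℝ, GoodBoussinesq.IsScalar f u p
            ((GoodBoussinesq.period u p * GoodBoussinesq.det₂ u p) •
              GoodBoussinesq.meanFree u p) r ↔
          r = GoodBoussinesq.period u p * GoodBoussinesq.det₂ u p * GoodBoussinesq.det₄ u p) ∧
        -- nondegeneracy of the scalar gives a local diffeomorphism
        (s ≠ 0 → GoodBoussinesq.IsLocalDiffeo Ω (GoodBoussinesq.conserved u) p) := by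
  open GoodBoussinesq in
  refine ⟨hu.contDiffOn_conserved hf hΩ, fun p hp hker => ?_⟩
  have H := hu.waveVariation hf hF hΩ hp
  have hT := H.period_pos
  have hK : KernelIsLine (period u p) (hillPotential f u p) fun x => u x p :=
    kernelIsLine_of_kerA_subset hT H.smooth_wave H.periodic_wave hker.subset
  obtain ⟨τ, hτ⟩ := H.exists_shift_particular
  obtain ⟨htc, hMc, hNc⟩ := H.variation_eq hτ
    (hu.hillSolves_dp hf hΩ hp 2 (pd_force 2 p) (pd_speed 2 p))
    (fun x => by
      simpa using hu.wronskian_dp hF hΩ hp 2 (pd_force 2 p) (pd_speed 2 p) (pd_coord 2 1 p) x)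
    (hu.dp_shift_slice hf hΩ hp 2)
  obtain ⟨htb, hMb, hNb⟩ := H.variation_eq hτ
    (hu.hillSolves_dp hf hΩ hp 3 (pd_force 3 p) (pd_speed 3 p))
    (fun x => by
      simpa using hu.wronskian_dp hF hΩ hp 3 (pd_force 3 p) (pd_speed 3 p) (pd_coord 3 1 p) x)
    (hu.dp_shift_slice hf hΩ hp 3)
  have hΔ := H.det_ne_zero hK
  have hmass : ∀ i, massVar (period u p) (fun x => u x p) (fun x => dp i (wave u) (x, p))
      (pd i (period u) p) = pd i (casimir₁ u) p := fun i => (hu.pd_casimir₁ hf hΩ hp i).symm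
  have hsquare : ∀ i, squareVar (period u p) (fun x => u x p) (fun x => dp i (wave u) (x, p))
      (pd i (period u) p) = pd i (secondMoment u) p := fun i =>
    (hu.pd_secondMoment hf hΩ hp i).symm
  set M₀ := massVar (period u p) (fun x => u x p)
    (WaveVariation.particular (fun x => u x p) fun x => dp 1 (wave u) (x, p)) τ with hM₀
  set N₀ := squareVar (period u p) (fun x => u x p)
    (WaveVariation.particular (fun x => u x p) fun x => dp 1 (wave u) (x, p)) τ with hN₀
  rw [hmass, hmass] at hΔ hMc hMb
  rw [hsquare, hsquare] at hNc hNb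
  have hdet₂ : det₂ u p = pd 0 (period u) p * pd 1 (casimir₁ u) p -
      pd 0 (casimir₁ u) p * pd 1 (period u) p := by
    rw [det₂, Matrix.det_fin_two_of]
  set Δ := pd 0 (period u) p * pd 1 (casimir₁ u) p -
      pd 0 (casimir₁ u) p * pd 1 (period u) p with hΔdef
  -- Cramer's rule with Δ ≠ 0: α and β cancel the period and mass variations of the particular
  -- solution, so that the corrected solution v is periodic and mean-zero.
  obtain ⟨α, β, hαβt, hαβm⟩ : ∃ α β : ℝ,
      τ + α * pd 0 (period u) p + β * pd 1 (period u) p = 0 ∧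
      M₀ + α * pd 0 (casimir₁ u) p + β * pd 1 (casimir₁ u) p = 0 := by
    refine ⟨(M₀ * pd 1 (period u) p - τ * pd 1 (casimir₁ u) p) / Δ,
      (τ * pd 0 (casimir₁ u) p - M₀ * pd 0 (period u) p) / Δ, ?_, ?_⟩
    · field_simp
      rw [hΔdef]
      ring
    · field_simp
      rw [hΔdef]
      ring
  obtain ⟨v, hv, hpv, hv0, hUv⟩ := H.exists_periodic_solution hτ hαβt
    (by rw [hmass, hmass]; exact hαβm)
  rw [hsquare, hsquare, intervalIntegral.integral_const_mul] at hUv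
  have hscalar := isRestrictedEntry_iff hT H.smooth_wave H.periodic_wave H.nonconstant hker hv hpv
    hv0 (4 * (1 - (1 - p 2 ^ 2)))
  rw [hu.integral_meanFree_sq hp] at hscalar
  set I := ∫ x in (0 : ℝ)..period u p, u x p * v x with hI
  set s := secondMoment u p - casimir₁ u p ^ 2 / period u p -
    4 * (1 - (1 - p 2 ^ 2)) * I with hs
  -- Eliminating τ and M₀ through α, β clears the T and M₁ entries of the reduced c-row and leaves
  -- 4c²I - N in the momentum column. The b-row reduces to (0, 0, M₁, T), so only a product of two
  -- 2×2 determinants remains.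
  have hrel : period u p * det₂ u p * s = det₄ u p := by
    have hIeq : I = (N₀ + α * pd 0 (secondMoment u) p + β * pd 1 (secondMoment u) p) / 2 := by
      linarith
    have hτeq : τ = -(α * pd 0 (period u) p + β * pd 1 (period u) p) := by linarith
    have hMeq : M₀ = -(α * pd 0 (casimir₁ u) p + β * pd 1 (casimir₁ u) p) := by linarith
    rw [det₄, det_fin_four, hdet₂, hs, hIeq]
    simp only [hu.pd_momentum hf hΩ hp, hu.pd_casimir₂ hf hΩ hp, htc, htb, hMc, hMb, hNc, hNb]
    rw [hτeq, hMeq, hΔdef]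
    simp
    field_simp
    ring
  refine ⟨hT, by rwa [hdet₂], s, fun r => ?_, hrel, fun r => ?_, fun hs0 => ?_⟩
  · have := hscalar 1 r
    rw [one_smul, one_pow, one_mul] at this
    exact this
  · refine (hscalar _ r).trans ?_
    rw [← hrel]
    constructor <;> intro h <;> rw [h] <;> ring
  · have hG := hu.contDiffOn_conserved hf hΩ
    refine isLocalDiffeo_of_det_ne_zero hΩ hG hp ?_
    rw [det_fderiv_conserved ((hG.contDiffAt (hΩ.mem_nhds hp)).differentiableAt (by simp)),
      neg_ne_zero, ← hrel, hdet₂]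
    exact mul_ne_zero (mul_ne_zero hT.ne' hΔ) hs0
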